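/- Let $X$ be a measurable space (for instance a subset of $\mathbb R^d$), let $L>0$, let $\rho$ be a probability measure on $X\times\mathbb R$ with $|y|\le L$ almost surely, with marginal $\rho_X$ on $X$ and regression function $f_\rho(x)=\int y\,d\rho(y|x)$, and let $\|\cdot\|_\rho$ be the norm of $L^2_{\rho_X}$. For every $N\ge 1$ let $\mathcal D_N=(\varphi_{N,i})_{i\le N}$ be a dictionary of $N$ measurable functions on $X$ with $\|\varphi_{N,i}\|_\rho=1$; for $h\in\mathrm{span}\,\mathcal D_N$ put $\|h\|_{\mathcal L_{1,N}}=\inf\{\sum_i|a_i| : h=\sum_i a_i\varphi_{N,i}\}$. For $r>0$ we say that $f\in\mathcal L_1^r$ with constant $B$ if for every $N\ge1$ there is $h\in\mathrm{span}\,\mathcal D_N$ with $\|h\|_{\mathcal L_{1,N}}\le B$ and $\|f-h\|_\rho\le BN^{-r}$. Let $z=(x_i,y_i)_{i=1}^n$, $n\ge2$, be drawn independently from $\rho$, put $\langle u,v\rangle_n=\frac1n\sum_{i=1}^n u_iv_i$ for vectors of values at the samples, $\|u\|_n=\langle u,u\rangle_n^{1/2}$, and let the atoms be the functions $g_i=\varphi_{N,i}/\|\varphi_{N,i}\|_n$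 (functions vanishing on the sample are left out), with coherence $M=\sup_{i\ne j}|\langle g_i,g_j\rangle_n|$. The orthogonal super greedy algorithm (OSGA) with step-size $s\ge1$ starts from $f_{z,0}^s=0$; its iteration $k$ selects $s$ atoms (all of them, if there are fewer than $s$) whose correlations $|\langle y-f_{z,k-1}^s,g\rangle_n|$ with the residual are largest, ties being broken arbitrarily, and lets $f_{z,k}^s$ be an orthogonal projection of $y$, for $\langle\cdot,\cdot\rangle_n$, onto the span of all atoms selected so far. Let $\Pi_Lt=\min\{L,|t|\}\,\mathrm{sgn}(t)$. Assume that $f_\rho\in\mathcal L_1^r$ with constant $B$, that $N\sim n^a$ with $a\ge\frac1{4r}$, and that the step-size $s\ge1$ and the iteration number $m$, which may depend on the sample, satisfy $s\le(2M)^{-1}+1$ almost surely. Then: (i) if $m\sim\frac1s\left(\frac n{\log n}\right)^{1/2}$, then $$E\left(\|\Pi_Lf_{z,m}^s-f_\rho\|_\rho^2\right)\le C\left(\frac n{\log n}\right)^{-1/2};$$ (ii) if $m\sim\frac{n^{1/2}}s$, then $$E\left(\|\Pi_Lf_{z,m}^s-f_\rho\|_\rho^2\right)\le C\,n^{-1/2}\log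 n.$$ Here $u\sim v$ means $cv\le u\le c'v$ with fixed positive constants $c,c'$, and $C$ depends only on $L$, $B$ (that is, on $f_\rho$ only through its norm in $\mathcal L_1^r$), $a$, $r$ and the constants in the relations $\sim$. -/

import Mathlib

open MeasureTheory ProbabilityTheory
open scoped ENNReal

universe u

namespace OSGA

noncomputable section

/-- The regression function `f_ρ(x) = ∫ y dρ(y|x)` of a probability measure `ρ` on `X × ℝ`. -/
def regression {X : Type u} [MeasurableSpace X] (ρ : Measure (X × ℝ)) [IsFiniteMeasure ρ]
    (x : X) : ℝ :=
  ∫ y, y ∂(ρ.condKernel x)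

/-- The truncation `Π_L t = min {L, |t|} sgn t`. -/
def trunc (L t : ℝ) : ℝ := min L |t| * Real.sign t

/-- The empirical inner product `(1/n) ∑ u_i v_i` of two vectors of values at the `n` samples. -/
def empInner {n : ℕ} (u v : Fin n → ℝ) : ℝ := (∑ i, u i * v i) / n

/-- The empirical norm. -/
def empNorm {n : ℕ} (u : Fin n → ℝ) : ℝ := Real.sqrt (empInner u u)

/-- The values of a function at the input points of the sample `z`. -/
def onSample {X : Type u} {n : ℕ} (z : Fin n → X × ℝ) (f : X → ℝ) : Fin n → ℝ :=
  fun i => f (z i).1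

/-- The vector of outputs of the sample `z`. -/
def outputs {X : Type u} {n : ℕ} (z : Fin n → X × ℝ) : Fin n → ℝ :=
  fun i => (z i).2

/-- The indices of the functions of the dictionary `φ` that do not vanish on the sample, so that
they can be normalized in the empirical norm. -/
def active {X : Type u} {n N : ℕ} (φ : Fin N → X → ℝ) (z : Fin n → X × ℝ) : Finset (Fin N) :=
  open Classical in Finset.univ.filter fun i => empNorm (onSample z (φ i)) ≠ 0

/-- The `i`-th atom: the `i`-th function of the dictionary, normalized in the empirical norm. -/
def atom {X : Type u} {n N : ℕ} (φ : Fin N → X → ℝ) (z : Fin n → X × ℝ) (i : Fin N) : X → ℝ :=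
  (empNorm (onSample z (φ i)))⁻¹ • φ i

/-- The coherence `M` of the dictionary of empirically normalized atoms, for the empirical
inner product. -/
def coherence {X : Type u} {n N : ℕ} (φ : Fin N → X → ℝ) (z : Fin n → X × ℝ) : ℝ≥0∞ :=
  ⨆ i ∈ active φ z, ⨆ j ∈ active φ z, ⨆ _ : i ≠ j,
    ENNReal.ofReal |empInner (onSample z (atom φ z i)) (onSample z (atom φ z j))|

/-- The span of the atoms that were selected in the first `k` iterations. -/
def selectedSpan {X : Type u} {n N : ℕ} (φ : Fin N → X → ℝ) (z : Fin n → X × ℝ)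
    (sel : ℕ → Finset (Fin N)) (k : ℕ) : Submodule ℝ (X → ℝ) :=
  Submodule.span ℝ {g | ∃ l < k, ∃ i ∈ sel l, g = atom φ z i}

/-- `m` iterations of the orthogonal super greedy algorithm with step-size `s` on the sample `z`.
Iteration number `k + 1` selects the set `sel k` of `s` atoms (all atoms, if there are fewer
than `s` of them) whose correlations with the current residual are largest in absolute value, and
`f (k + 1)` is an orthogonal projection, for the empirical inner product, of the outputs onto the
span of all the atoms selected so far. -/
structure IsRun {X : Type u} {n N : ℕ} (φ : Fin N → X → ℝ) (z : Fin n → X × ℝ) (s m : ℕ)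
    (sel : ℕ → Finset (Fin N)) (f : ℕ → X → ℝ) : Prop where
  init : f 0 = 0
  sel_subset : ∀ k < m, sel k ⊆ active φ z
  sel_card : ∀ k < m, (sel k).card = min s (active φ z).card
  sel_top : ∀ k < m, ∀ i ∈ sel k, ∀ j ∈ active φ z, j ∉ sel k →
    |empInner (outputs z - onSample z (f k)) (onSample z (atom φ z j))| ≤
      |empInner (outputs z - onSample z (f k)) (onSample z (atom φ z i))|
  proj_mem : ∀ k < m, f (k + 1) ∈ selectedSpan φ z sel (k + 1)
  proj_orthogonal : ∀ k < m, ∀ v ∈ selectedSpan φ z sel (k + 1),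
    empInner (outputs z - onSample z (f (k + 1))) (onSample z v) = 0

/-- `F` is an output `f^s_{z,m}` of the orthogonal super greedy algorithm (ties in the selection
may be broken in any way). -/
def IsEstimator {X : Type u} {n N : ℕ} (φ : Fin N → X → ℝ) (z : Fin n → X × ℝ) (s m : ℕ)
    (F : X → ℝ) : Prop :=
  ∃ (sel : ℕ → Finset (Fin N)) (f : ℕ → X → ℝ), IsRun φ z s m sel f ∧ F = f m

/-- The norm `inf {∑ |a_i| : h = ∑ a_i φ_i}` on the span of the dictionary `φ`. -/
def l1Norm {X : Type u} {N : ℕ} (φ : Fin N → X → ℝ) (h : X → ℝ) : ℝ :=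
  sInf {t | ∃ a : Fin N → ℝ, h = ∑ i, a i • φ i ∧ t = ∑ i, |a i|}

/-- `f` belongs to the class `L_1^r` of the dictionaries `φ N` (of size `N = 1, 2, …`), with the
constant `B`: its norm in `L_1^r` is the smallest such `B`. -/
def MemL1r {X : Type u} [MeasurableSpace X] (φ : (N : ℕ) → Fin N → X → ℝ) (μ : Measure X)
    (r : ℝ) (f : X → ℝ) (B : ℝ) : Prop :=
  ∀ N : ℕ, 1 ≤ N → ∃ h ∈ Submodule.span ℝ (Set.range (φ N)),
    l1Norm (φ N) h ≤ B ∧ eLpNorm (f - h) 2 μ ≤ ENNReal.ofReal (B * (N : ℝ) ^ (-r))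

/-- The expected squared error `E ‖Π_L F_z - f_ρ‖_ρ²` over the sample `z` of `n` independent
draws from `ρ`. -/
def risk {X : Type u} [MeasurableSpace X] (ρ : Measure (X × ℝ)) [IsProbabilityMeasure ρ] (L : ℝ)
    {n : ℕ} (F : (Fin n → X × ℝ) → X → ℝ) : ℝ≥0∞ :=
  ∫⁻ z, eLpNorm (fun x => trunc L (F z x) - regression ρ x) 2 ρ.fst ^ 2
    ∂(Measure.pi fun _ : Fin n => ρ)

end

end OSGA

/-! The error splits into approximation, optimization and complexity. Write `q` for the order of the
number `s * m` of selected atoms; these cost `N ^ (-2r)`, `1 / q` and `q * log n / n`. The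
assumption on `a` makes the first at most of order `n ^ (-1/2)`, and the two choices of `m` set the
other two.

Optimization (`IsGreedyRun.norm_sq_le`) is deterministic. By the step-size condition, blocks of `s`
atoms are nearly orthonormal, so an iteration gains at least 2/3 of the sum `Q` of the squared
correlations of its new atoms. The excess over a competitor `∑ a i • g i` is bounded by the
correlations weighted by `a`. Unselected atoms have squared correlation at most `Q / s`. For
selected atoms one needs `∑ a i ^ 2 ≲ (∑ |a i|) ^ 2 / s`, which fails for a few large coefficients;
`excess_one_add_le` shows that the first iteration disposes of these: as long as the excess is
positive, the coefficients outside its block satisfy that bound, and the atoms inside it are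
orthogonal to all later residuals. Then excess² ≲ gain, whence the decay `1 / (s * m)`.

Complexity (`exists_cover`, `integral_risk_le`) uses a ghost sample. Truncated combinations of at
most `D` dictionary elements have a cover on the `2n` points whose log-cardinality is of order `D *
log n`, by Sauer–Shelah applied to their subgraphs. The risk minus four times the empirical excess
is a fluctuation that is odd under exchanging sample and ghost points, plus a negative drift that
dominates the variance of the fluctuation. Exponential moments over random swaps therefore stay
bounded by 1, and a union bound over the cover costs only `log K / n`, not its square root.

The competitor is a fixed function close to the regression function, so its empirical excess and the
empirical norms of the dictionary are simply integrated; no concentration for them is needed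
(`risk_le`). -/

/-! ### Greedy approximation with a coherent dictionary in an inner product space -/

section Coherent

variable {H : Type*} [NormedAddCommGroup H] [InnerProductSpace ℝ H] {ι : Type*}

open scoped RealInnerProductSpace in
/-- Normalized vectors indexed by `act` with coherence at most `M`. -/
structure IsCoherent (g : ι → H) (act : Finset ι) (M : ℝ) : Prop where
  nonneg : 0 ≤ M
  norm_eq : ∀ i ∈ act, ‖g i‖ = 1
  inner_le : ∀ i ∈ act, ∀ j ∈ act, i ≠ j → |⟪g i, g j⟫| ≤ M

open scoped RealInnerProductSpace

namespace IsCoherent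

variable {g : ι → H} {act S : Finset ι} {M : ℝ}

theorem abs_inner_sum_le (hg : IsCoherent g act M) (hS : S ⊆ act) (c : ι → ℝ) {i : ι}
    (hi : i ∈ act) (hiS : i ∉ S) : |⟪∑ j ∈ S, c j • g j, g i⟫| ≤ M * ∑ j ∈ S, |c j| := by
  rw [sum_inner, Finset.mul_sum]
  refine (Finset.abs_sum_le_sum_abs _ _).trans (Finset.sum_le_sum fun j hj => ?_)
  rw [real_inner_smul_left, abs_mul, mul_comm]
  exact mul_le_mul_of_nonneg_right
    (hg.inner_le j (hS hj) i hi (fun h => hiS (h ▸ hj))) (abs_nonneg _)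

theorem abs_inner_sum_sub_le (hg : IsCoherent g act M) (hS : S ⊆ act) (c : ι → ℝ) {i : ι}
    (hi : i ∈ S) : |⟪∑ j ∈ S, c j • g j, g i⟫ - c i| ≤ M * (∑ j ∈ S, |c j| - |c i|) := by
  classical
  have h1 := hg.abs_inner_sum_le ((Finset.erase_subset i S).trans hS) c (hS hi)
    (Finset.notMem_erase i S)
  rw [← Finset.add_sum_erase S _ hi, ← Finset.add_sum_erase S (fun j => |c j|) hi, inner_add_left,
    real_inner_smul_left, real_inner_self_eq_norm_sq, hg.norm_eq i (hS hi)]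
  convert h1 using 2 <;> ring

/-- The Gram matrix has unit diagonal, and its off-diagonal entries, bounded by `M`, make up the
whole difference. -/
theorem abs_norm_sq_sub_le (hg : IsCoherent g act M) (hS : S ⊆ act) (c : ι → ℝ) :
    |‖∑ j ∈ S, c j • g j‖ ^ 2 - ∑ j ∈ S, c j ^ 2| ≤
      M * ((∑ j ∈ S, |c j|) ^ 2 - ∑ j ∈ S, c j ^ 2) := by
  have h : ‖∑ j ∈ S, c j • g j‖ ^ 2 - ∑ j ∈ S, c j ^ 2 =
      ∑ i ∈ S, c i * (⟪∑ j ∈ S, c j • g j, g i⟫ - c i) := by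
    rw [← real_inner_self_eq_norm_sq]
    conv_lhs => enter [1]; rw [inner_sum]
    rw [← Finset.sum_sub_distrib]
    refine Finset.sum_congr rfl fun i _ => ?_
    rw [real_inner_smul_right]; ring
  rw [h]
  refine (Finset.abs_sum_le_sum_abs _ _).trans ?_
  calc ∑ i ∈ S, |c i * (⟪∑ j ∈ S, c j • g j, g i⟫ - c i)|
      ≤ ∑ i ∈ S, |c i| * (M * (∑ j ∈ S, |c j| - |c i|)) := by
        refine Finset.sum_le_sum fun i hi => ?_
        rw [abs_mul]
        exact mul_le_mul_of_nonneg_left (hg.abs_inner_sum_sub_le hS c hi) (abs_nonneg _)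
    _ = M * ((∑ j ∈ S, |c j|) ^ 2 - ∑ j ∈ S, c j ^ 2) := by
        rw [sq, Finset.sum_mul, ← Finset.sum_sub_distrib, Finset.mul_sum]
        refine Finset.sum_congr rfl fun i _ => ?_
        rw [← sq_abs (c i)]; ring

/-- The step-size condition: sets of at most `s` atoms are nearly orthonormal. -/
structure _root_.StepSize (M : ℝ) (s : ℕ) : Prop where
  one_le : 1 ≤ s
  mul_sub_one_le : M * ((s : ℝ) - 1) ≤ 1 / 2
  mul_le : M * s ≤ 1

theorem abs_norm_sq_sub_le_half (hg : IsCoherent g act M) {s : ℕ} (hs : StepSize M s)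
    (hS : S ⊆ act) (hcard : S.card ≤ s) (c : ι → ℝ) :
    |‖∑ j ∈ S, c j • g j‖ ^ 2 - ∑ j ∈ S, c j ^ 2| ≤ 1 / 2 * ∑ j ∈ S, c j ^ 2 := by
  refine (hg.abs_norm_sq_sub_le hS c).trans ?_
  have h1 : (∑ j ∈ S, |c j|) ^ 2 ≤ S.card * ∑ j ∈ S, c j ^ 2 := by
    simpa using sq_sum_le_card_mul_sum_sq (s := S) (f := fun j => |c j|)
  have h2 : (S.card : ℝ) ≤ s := by exact_mod_cast hcard
  have h3 : 0 ≤ ∑ j ∈ S, c j ^ 2 := Finset.sum_nonneg fun _ _ => sq_nonneg _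
  calc M * ((∑ j ∈ S, |c j|) ^ 2 - ∑ j ∈ S, c j ^ 2)
      ≤ M * (s * ∑ j ∈ S, c j ^ 2 - ∑ j ∈ S, c j ^ 2) :=
        mul_le_mul_of_nonneg_left (by nlinarith) hg.nonneg
    _ = (M * (s - 1)) * ∑ j ∈ S, c j ^ 2 := by ring
    _ ≤ _ := mul_le_mul_of_nonneg_right hs.mul_sub_one_le h3

end IsCoherent

/-- A run of the orthogonal super greedy algorithm in an inner product space. -/
structure IsGreedyRun (g : ι → H) (act : Finset ι) (y : H) (s m : ℕ)
    (sel : ℕ → Finset ι) (f : ℕ → H) : Prop where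
  init : f 0 = 0
  sel_subset : ∀ k < m, sel k ⊆ act
  sel_card : ∀ k < m, (sel k).card = min s act.card
  sel_top : ∀ k < m, ∀ i ∈ sel k, ∀ j ∈ act, j ∉ sel k → |⟪y - f k, g j⟫| ≤ |⟪y - f k, g i⟫|
  proj_mem : ∀ k < m, f (k + 1) ∈ Submodule.span ℝ {v | ∃ l < k + 1, ∃ i ∈ sel l, v = g i}
  proj_orthogonal : ∀ k < m, ∀ l < k + 1, ∀ i ∈ sel l, ⟪y - f (k + 1), g i⟫ = 0

namespace IsGreedyRun

variable {g : ι → H} {act : Finset ι} {M : ℝ} {y : H} {s m : ℕ} {sel : ℕ → Finset ι} {f : ℕ → H}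

theorem inner_eq_zero_of_mem_span (hrun : IsGreedyRun g act y s m sel f) {k : ℕ} (hk : k < m)
    {v : H} (hv : v ∈ Submodule.span ℝ {v | ∃ l < k + 1, ∃ i ∈ sel l, v = g i}) :
    ⟪y - f (k + 1), v⟫ = 0 := by
  induction hv using Submodule.span_induction with
  | mem x hx => obtain ⟨l, hl, i, hi, rfl⟩ := hx; exact hrun.proj_orthogonal k hk l hl i hi
  | zero => simp
  | add a b _ _ ha hb => rw [inner_add_right, ha, hb, add_zero]
  | smul t a _ ha => rw [real_inner_smul_right, ha, mul_zero]

theorem inner_self_eq_zero (hrun : IsGreedyRun g act y s m sel f) {k : ℕ} (hk : k ≤ m) :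
    ⟪y - f k, f k⟫ = 0 := by
  cases k with
  | zero => simp [hrun.init]
  | succ k => exact hrun.inner_eq_zero_of_mem_span hk (hrun.proj_mem k hk)

/-- An atom left over shows that the iteration did not run short of atoms. -/
theorem card_eq (hrun : IsGreedyRun g act y s m sel f) {k : ℕ} (hk : k < m) {j : ι}
    (hj : j ∈ act) (hjk : j ∉ sel k) : (sel k).card = s := by
  have h := Finset.card_lt_card
    (Finset.ssubset_iff_subset_ne.2 ⟨hrun.sel_subset k hk, fun h => hjk (h ▸ hj)⟩)
  have := hrun.sel_card k hk
  omega

theorem card_le (hrun : IsGreedyRun g act y s m sel f) {k : ℕ} (hk : k < m) :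
    (sel k).card ≤ s := (hrun.sel_card k hk).trans_le (min_le_left _ _)

/-- The residual is orthogonal to `f k`. This reduces upper bounds on the excess to correlations of
the residual with the atoms of `h`. -/
theorem excess_eq (hrun : IsGreedyRun g act y s m sel f) {k : ℕ} (hk : k ≤ m) (h : H) :
    ‖y - f k‖ ^ 2 - ‖y - h‖ ^ 2 = 2 * ⟪y - f k, h⟫ - ‖f k - h‖ ^ 2 := by
  have h1 : y - h = (y - f k) + (f k - h) := by abel
  rw [h1, norm_add_sq_real, inner_sub_right, hrun.inner_self_eq_zero hk]
  ring

theorem norm_sq_succ_le (hrun : IsGreedyRun g act y s m sel f) {k : ℕ} (hk : k < m) {v : H}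
    (hv : f k + v ∈ Submodule.span ℝ {v | ∃ l < k + 1, ∃ i ∈ sel l, v = g i}) :
    ‖y - f (k + 1)‖ ^ 2 ≤ ‖y - f k - v‖ ^ 2 := by
  have h1 : y - f k - v = (y - f (k + 1)) + (f (k + 1) - (f k + v)) := by abel
  rw [h1, norm_add_sq_real, hrun.inner_eq_zero_of_mem_span hk
    (Submodule.sub_mem _ (hrun.proj_mem k hk) hv)]
  nlinarith [sq_nonneg ‖f (k + 1) - (f k + v)‖]

theorem mem_span_succ (hrun : IsGreedyRun g act y s m sel f) {k : ℕ} (hk : k ≤ m) :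
    f k ∈ Submodule.span ℝ {v | ∃ l < k + 1, ∃ i ∈ sel l, v = g i} := by
  cases k with
  | zero => simp [hrun.init]
  | succ k =>
    refine Submodule.span_mono ?_ (hrun.proj_mem k hk)
    rintro v ⟨l, hl, i, hi, rfl⟩
    exact ⟨l, by omega, i, hi, rfl⟩

/-- The energy gained in one iteration dominates the squared correlations of the new atoms. -/
theorem sum_sq_inner_le (hrun : IsGreedyRun g act y s m sel f) (hg : IsCoherent g act M)
    (hs : StepSize M s) {k : ℕ} (hk : k < m) :
    ∑ i ∈ sel k, ⟪y - f k, g i⟫ ^ 2 ≤ 3 / 2 * (‖y - f k‖ ^ 2 - ‖y - f (k + 1)‖ ^ 2) := by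
  set x : ι → ℝ := fun i => ⟪y - f k, g i⟫ with hx
  set v := ∑ i ∈ sel k, x i • g i with hv
  -- Moving by `t • v` gains at least `(2t - 3t²/2)` times the sum of squares, as `‖v‖ ^ 2` is at
  -- most 3/2 of it; `t = 2/3` is optimal.
  have hmem : f k + (2 / 3 : ℝ) • v ∈
      Submodule.span ℝ {v | ∃ l < k + 1, ∃ i ∈ sel l, v = g i} :=
    Submodule.add_mem _ (hrun.mem_span_succ hk.le) (Submodule.smul_mem _ _
      (Submodule.sum_mem _ fun i hi => Submodule.smul_mem _ _
        (Submodule.subset_span ⟨k, by omega, i, hi, rfl⟩)))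
  have h1 := hrun.norm_sq_succ_le hk hmem
  have h2 : ⟪y - f k, v⟫ = ∑ i ∈ sel k, x i ^ 2 := by
    rw [hv, inner_sum]
    exact Finset.sum_congr rfl fun i _ => by rw [real_inner_smul_right, sq]
  have h3 := (abs_le.1 (hg.abs_norm_sq_sub_le_half hs (hrun.sel_subset k hk)
    (hrun.card_le hk) x)).2
  rw [norm_sub_sq_real (y - f k), real_inner_smul_right, h2, norm_smul, mul_pow, Real.norm_eq_abs,
    sq_abs] at h1
  change ∑ i ∈ sel k, x i ^ 2 ≤ _
  nlinarith

theorem sum_abs_inner_lower (hrun : IsGreedyRun g act y s m sel f) {k : ℕ} (hk : k < m) {j : ι}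
    (hj : j ∈ act) (hjk : j ∉ sel k) :
    s * |⟪y - f k, g j⟫| ≤ ∑ i ∈ sel k, |⟪y - f k, g i⟫| := by
  rw [← hrun.card_eq hk hj hjk, ← nsmul_eq_mul]
  exact Finset.card_nsmul_le_sum _ _ _ fun i hi => hrun.sel_top k hk i hi j hj hjk

theorem sum_sq_inner_lower (hrun : IsGreedyRun g act y s m sel f) {k : ℕ} (hk : k < m) {j : ι}
    (hj : j ∈ act) (hjk : j ∉ sel k) :
    s * ⟪y - f k, g j⟫ ^ 2 ≤ ∑ i ∈ sel k, ⟪y - f k, g i⟫ ^ 2 := by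
  rw [← hrun.card_eq hk hj hjk, ← nsmul_eq_mul]
  exact Finset.card_nsmul_le_sum _ _ _ fun i hi =>
    sq_le_sq.2 (hrun.sel_top k hk i hi j hj hjk)

/-- After the first iteration, either the excess energy is not positive or the remaining
coefficients are small. -/
theorem excess_one_add_le (hrun : IsGreedyRun g act y s m sel f) (hg : IsCoherent g act M)
    (hs : StepSize M s) (hm : 0 < m) (a : ι → ℝ) [DecidableEq ι] :
    ‖y - f 1‖ ^ 2 - ‖y - ∑ i ∈ act, a i • g i‖ ^ 2 + ∑ i ∈ act \ sel 0, a i ^ 2 ≤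
      31 * ((∑ i ∈ act, |a i|) ^ 2 / s) := by
  have hs0 : (0 : ℝ) < s := by exact_mod_cast hs.one_le
  have hS := hrun.sel_subset 0 hm
  set S := sel 0 with hSdef
  set R := act \ S with hR
  set A := ∑ i ∈ act, |a i| with hA
  have hRA : R ⊆ act := Finset.sdiff_subset
  have hMs : M ≤ 1 / s := by rw [le_div_iff₀ hs0]; exact hs.mul_le
  have hA0 : 0 ≤ A := Finset.sum_nonneg fun _ _ => abs_nonneg _
  have hAsplit : ∑ i ∈ R, |a i| + ∑ i ∈ S, |a i| = A := Finset.sum_sdiff hS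
  have hAS0 : 0 ≤ ∑ i ∈ S, |a i| := Finset.sum_nonneg fun _ _ => abs_nonneg _
  have hAR0 : 0 ≤ ∑ i ∈ R, |a i| := Finset.sum_nonneg fun _ _ => abs_nonneg _
  obtain ⟨b, hb⟩ : ∃ b : ι → ℝ, f 1 = ∑ j ∈ S, b j • g j := by
    have h1 := hrun.proj_mem 0 hm
    have h2 : {v | ∃ l < 0 + 1, ∃ i ∈ sel l, v = g i} = g '' (S : Set ι) := by
      ext v
      simp [hSdef, eq_comm]
    rw [h2, Submodule.mem_span_image_finset_iff_exists_fun] at h1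
    obtain ⟨b, hb⟩ := h1
    refine ⟨fun i => if hi : i ∈ S then b ⟨i, hi⟩ else 0, hb.symm.trans ?_⟩
    rw [← Finset.sum_coe_sort S]
    exact Finset.sum_congr rfl fun i _ => by simp
  -- The mass `C` of this coefficient error is not controlled a priori. It enters the correlations
  -- linearly and `‖f 1 - h‖ ^ 2` quadratically, so it is eliminated at the end.
  set c : ι → ℝ := fun j => b j - a j with hc
  set C := ∑ j ∈ S, |c j| with hC
  have hC0 : 0 ≤ C := Finset.sum_nonneg fun _ _ => abs_nonneg _
  have hB : ∑ j ∈ S, |b j| ≤ C + A := by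
    calc ∑ j ∈ S, |b j| ≤ ∑ j ∈ S, (|c j| + |a j|) := Finset.sum_le_sum fun j _ => by
          have := abs_add_le (c j) (a j)
          simpa [hc] using this
      _ ≤ C + A := by rw [Finset.sum_add_distrib]; linarith
  have hBnn : 0 ≤ ∑ j ∈ S, |b j| := Finset.sum_nonneg fun _ _ => abs_nonneg _
  have horth : ∀ j ∈ S, ⟪y - f 1, g j⟫ = 0 := fun j hj =>
    hrun.proj_orthogonal 0 hm 0 (by omega) j hj
  -- The greedy choice compares `⟪y, g i⟫` with the average over the block, where `y` may be
  -- replaced by its projection `f 1` (3/2); low coherence bounds `⟪f 1, g i⟫` (1).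
  have hcorr : ∀ i ∈ R, |⟪y - f 1, g i⟫| ≤ 5 / 2 * ((C + A) / s) := by
    intro i hi
    have hiA : i ∈ act := hRA hi
    have hiS : i ∉ S := (Finset.mem_sdiff.1 hi).2
    have h1 := hrun.sum_abs_inner_lower hm hiA hiS
    rw [hrun.init, sub_zero] at h1
    have hcard := hrun.card_eq hm hiA hiS
    have h2 : ∑ j ∈ S, |⟪y, g j⟫| ≤ 3 / 2 * ∑ j ∈ S, |b j| := by
      calc ∑ j ∈ S, |⟪y, g j⟫|
          ≤ ∑ j ∈ S, (|b j| + M * (∑ l ∈ S, |b l| - |b j|)) := by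
            refine Finset.sum_le_sum fun j hj => ?_
            have h3 := hg.abs_inner_sum_sub_le hS b hj
            have h4 : ⟪y, g j⟫ = ⟪f 1, g j⟫ := by
              have := horth j hj
              rw [inner_sub_left] at this; linarith
            rw [h4, hb]
            have h5 := abs_add_le (⟪∑ j ∈ S, b j • g j, g j⟫ - b j) (b j)
            rw [sub_add_cancel] at h5
            linarith
        _ = (1 + M * (s - 1)) * ∑ j ∈ S, |b j| := by
            rw [Finset.sum_add_distrib, ← Finset.mul_sum, Finset.sum_sub_distrib,
              Finset.sum_const, nsmul_eq_mul, hSdef, hcard]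
            ring
        _ ≤ _ := mul_le_mul_of_nonneg_right (by linarith [hs.mul_sub_one_le]) hBnn
    have h3 : |⟪f 1, g i⟫| ≤ (C + A) / s := by
      rw [hb]
      refine (hg.abs_inner_sum_le hS b hiA hiS).trans ?_
      calc M * ∑ j ∈ S, |b j| ≤ 1 / s * (C + A) :=
            mul_le_mul hMs hB hBnn (by positivity)
        _ = _ := by ring
    have h4 : |⟪y, g i⟫| ≤ 3 / 2 * ((C + A) / s) := by
      rw [← mul_div_assoc, le_div_iff₀ hs0]
      linarith
    rw [inner_sub_left]
    have := abs_sub ⟪y, g i⟫ ⟪f 1, g i⟫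
    linarith
  have hinner : ⟪y - f 1, ∑ i ∈ act, a i • g i⟫ ≤ A * (5 / 2 * ((C + A) / s)) := by
    rw [inner_sum, ← Finset.sum_sdiff hS, Finset.sum_eq_zero (s := S), add_zero]
    · calc ∑ i ∈ R, ⟪y - f 1, a i • g i⟫ ≤ ∑ i ∈ R, |a i| * (5 / 2 * ((C + A) / s)) := by
            refine Finset.sum_le_sum fun i hi => ?_
            rw [real_inner_smul_right]
            refine (le_abs_self _).trans ?_
            rw [abs_mul]
            exact mul_le_mul_of_nonneg_left (hcorr i hi) (abs_nonneg _)
        _ ≤ _ := by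
            rw [← Finset.sum_mul]
            exact mul_le_mul_of_nonneg_right (by linarith) (by positivity)
    · intro i hi
      rw [real_inner_smul_right, horth i hi, mul_zero]
  have hnorm : C ^ 2 / (2 * s) + ∑ i ∈ R, a i ^ 2 - A ^ 2 / s - 2 * (C * A / s) ≤
      ‖f 1 - ∑ i ∈ act, a i • g i‖ ^ 2 := by
    have h1 : f 1 - ∑ i ∈ act, a i • g i =
        ∑ j ∈ S, c j • g j - ∑ i ∈ R, a i • g i := by
      rw [hb, ← Finset.sum_sdiff hS]
      simp only [hc, sub_smul, Finset.sum_sub_distrib]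
      abel
    rw [h1, norm_sub_sq_real]
    have h2 := (abs_le.1 (hg.abs_norm_sq_sub_le_half hs hS (hrun.card_le hm) c)).1
    have h3 := (abs_le.1 (hg.abs_norm_sq_sub_le hRA a)).1
    have h4 : ⟪∑ j ∈ S, c j • g j, ∑ i ∈ R, a i • g i⟫ ≤ C * A / s := by
      rw [inner_sum]
      calc ∑ i ∈ R, ⟪∑ j ∈ S, c j • g j, a i • g i⟫ ≤ ∑ i ∈ R, |a i| * (M * C) := by
            refine Finset.sum_le_sum fun i hi => ?_
            rw [real_inner_smul_right]
            refine (le_abs_self _).trans ?_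
            rw [abs_mul]
            exact mul_le_mul_of_nonneg_left
              (hg.abs_inner_sum_le hS c (hRA hi) (Finset.mem_sdiff.1 hi).2) (abs_nonneg _)
        _ ≤ A * (1 / s * C) := by
            rw [← Finset.sum_mul]
            exact mul_le_mul (by linarith) (mul_le_mul_of_nonneg_right hMs hC0)
              (mul_nonneg hg.nonneg hC0) hA0
        _ = _ := by ring
    have h5 : C ^ 2 / (2 * s) ≤ 1 / 2 * ∑ j ∈ S, c j ^ 2 := by
      have h6 : C ^ 2 ≤ S.card * ∑ j ∈ S, c j ^ 2 := by
        simpa using sq_sum_le_card_mul_sum_sq (s := S) (f := fun j => |c j|)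
      have h7 : (S.card : ℝ) ≤ s := by exact_mod_cast hrun.card_le hm
      have h8 : 0 ≤ ∑ j ∈ S, c j ^ 2 := Finset.sum_nonneg fun _ _ => sq_nonneg _
      rw [div_le_iff₀ (by positivity)]
      nlinarith
    have h9 : M * ((∑ j ∈ R, |a j|) ^ 2 - ∑ j ∈ R, a j ^ 2) ≤ A ^ 2 / s := by
      have h10 : 0 ≤ ∑ j ∈ R, a j ^ 2 := Finset.sum_nonneg fun _ _ => sq_nonneg _
      have h11 : (∑ j ∈ R, |a j|) ^ 2 ≤ A ^ 2 := pow_le_pow_left₀ hAR0 (by linarith) 2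
      calc M * ((∑ j ∈ R, |a j|) ^ 2 - ∑ j ∈ R, a j ^ 2) ≤ M * A ^ 2 :=
            mul_le_mul_of_nonneg_left (by linarith) hg.nonneg
        _ ≤ 1 / s * A ^ 2 := mul_le_mul_of_nonneg_right hMs (sq_nonneg _)
        _ = _ := by ring
    linarith
  have hex := hrun.excess_eq (k := 1) hm (∑ i ∈ act, a i • g i)
  -- The left side is `(6A² + 7AC - C²/2) / s`, largest at `C = 7A`, with value `30.5 A² / s`.
  have hfin : 2 * (A * (5 / 2 * ((C + A) / s))) - C ^ 2 / (2 * s) + A ^ 2 / s +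
      2 * (C * A / s) ≤ 31 * (A ^ 2 / s) := by
    have : 31 * (A ^ 2 / s) - (2 * (A * (5 / 2 * ((C + A) / s))) - C ^ 2 / (2 * s) + A ^ 2 / s +
      2 * (C * A / s)) = ((C - 7 * A) ^ 2 / 2 + A ^ 2 / 2) / s := by
      field_simp
      ring
    have h2 : 0 ≤ ((C - 7 * A) ^ 2 / 2 + A ^ 2 / 2) / s := by positivity
    linarith
  linarith

/-- The recursion behind the rate. Unselected atoms are handled by the greedy choice, selected ones
by Cauchy–Schwarz and `ha`; atoms of the first block no longer correlate with the residual. -/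
theorem excess_sq_le (hrun : IsGreedyRun g act y s m sel f) (hg : IsCoherent g act M)
    (hs : StepSize M s) [DecidableEq ι] (a : ι → ℝ)
    (ha : ∑ i ∈ act \ sel 0, a i ^ 2 ≤ 31 * ((∑ i ∈ act, |a i|) ^ 2 / s))
    {k : ℕ} (hk0 : 0 < k) (hk : k < m)
    (hpos : 0 ≤ ‖y - f k‖ ^ 2 - ‖y - ∑ i ∈ act, a i • g i‖ ^ 2) :
    (‖y - f k‖ ^ 2 - ‖y - ∑ i ∈ act, a i • g i‖ ^ 2) ^ 2 ≤
      300 * ((∑ i ∈ act, |a i|) ^ 2 / s) * (‖y - f k‖ ^ 2 - ‖y - f (k + 1)‖ ^ 2) := by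
  have hs0 : (0 : ℝ) < s := by exact_mod_cast hs.one_le
  set A := ∑ i ∈ act, |a i| with hA
  have hA0 : 0 ≤ A := Finset.sum_nonneg fun _ _ => abs_nonneg _
  set x : ι → ℝ := fun i => ⟪y - f k, g i⟫ with hx
  set Q := ∑ i ∈ sel k, x i ^ 2 with hQ
  have hQ0 : 0 ≤ Q := Finset.sum_nonneg fun _ _ => sq_nonneg _
  have hgain : Q ≤ 3 / 2 * (‖y - f k‖ ^ 2 - ‖y - f (k + 1)‖ ^ 2) :=
    hrun.sum_sq_inner_le hg hs hk
  have hx0 : ∀ i ∈ sel 0, x i = 0 := by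
    intro i hi
    obtain ⟨l, rfl⟩ := Nat.exists_eq_add_of_lt hk0
    exact hrun.proj_orthogonal _ (by omega) 0 (by omega) i hi
  have hd : ‖y - f k‖ ^ 2 - ‖y - ∑ i ∈ act, a i • g i‖ ^ 2 ≤ 2 * ∑ i ∈ act, |a i| * |x i| := by
    rw [hrun.excess_eq hk.le, inner_sum]
    have h1 : ∑ i ∈ act, ⟪y - f k, a i • g i⟫ ≤ ∑ i ∈ act, |a i| * |x i| := by
      refine Finset.sum_le_sum fun i _ => ?_
      rw [real_inner_smul_right, ← abs_mul]
      exact le_abs_self _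
    nlinarith [sq_nonneg ‖f k - ∑ i ∈ act, a i • g i‖]
  have h1 : ∑ i ∈ act \ sel k, |a i| * |x i| ≤ A * √(Q / s) := by
    calc ∑ i ∈ act \ sel k, |a i| * |x i| ≤ ∑ i ∈ act \ sel k, |a i| * √(Q / s) := by
          refine Finset.sum_le_sum fun i hi => mul_le_mul_of_nonneg_left ?_ (abs_nonneg _)
          rw [Finset.mem_sdiff] at hi
          refine Real.abs_le_sqrt ?_
          rw [le_div_iff₀ hs0, mul_comm]
          exact hrun.sum_sq_inner_lower hk hi.1 hi.2
      _ ≤ _ := by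
          rw [← Finset.sum_mul]
          refine mul_le_mul_of_nonneg_right ?_ (Real.sqrt_nonneg _)
          exact Finset.sum_le_sum_of_subset_of_nonneg Finset.sdiff_subset
            fun _ _ _ => abs_nonneg _
  have h2 : ∑ i ∈ sel k, |a i| * |x i| ≤ √(31 * (A ^ 2 / s)) * √Q := by
    have h3 : ∑ i ∈ sel k, |a i| * |x i| = ∑ i ∈ sel k \ sel 0, |a i| * |x i| := by
      refine (Finset.sum_subset Finset.sdiff_subset fun i hi hi' => ?_).symm
      have : i ∈ sel 0 := by
        by_contra h
        exact hi' (Finset.mem_sdiff.2 ⟨hi, h⟩)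
      rw [hx0 i this, abs_zero, mul_zero]
    rw [h3]
    refine (Real.sum_mul_le_sqrt_mul_sqrt _ _ _).trans ?_
    simp only [sq_abs]
    refine mul_le_mul (Real.sqrt_le_sqrt ?_) (Real.sqrt_le_sqrt ?_) (Real.sqrt_nonneg _)
      (Real.sqrt_nonneg _)
    · refine le_trans (Finset.sum_le_sum_of_subset_of_nonneg ?_ fun _ _ _ => sq_nonneg _) ha
      exact Finset.sdiff_subset_sdiff (hrun.sel_subset k hk) le_rfl
    · exact Finset.sum_le_sum_of_subset_of_nonneg Finset.sdiff_subset fun _ _ _ => sq_nonneg _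
  have h3 : ‖y - f k‖ ^ 2 - ‖y - ∑ i ∈ act, a i • g i‖ ^ 2 ≤
      2 * (A * √(Q / s) + √(31 * (A ^ 2 / s)) * √Q) := by
    have := Finset.sum_sdiff (hrun.sel_subset k hk) (f := fun i => |a i| * |x i|)
    linarith
  -- The sum is `(1 + √31) * √(A ^ 2 / s * Q)`. The final constant is `300 = 4 * 50 * 3/2`.
  have h4 : (A * √(Q / s) + √(31 * (A ^ 2 / s)) * √Q) ^ 2 ≤ 50 * (A ^ 2 / s * Q) := by
    have e1 : A * √(Q / s) = √(A ^ 2 / s * Q) := by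
      rw [show A ^ 2 / s * Q = A ^ 2 * (Q / s) by ring, Real.sqrt_mul (sq_nonneg _),
        Real.sqrt_sq hA0]
    have e2 : √(31 * (A ^ 2 / s)) * √Q = √31 * √(A ^ 2 / s * Q) := by
      rw [← Real.sqrt_mul (by positivity), ← Real.sqrt_mul (by norm_num), mul_assoc]
    have h31 : √31 ≤ 6 := Real.sqrt_le_iff.2 ⟨by norm_num, by norm_num⟩
    have e3 : √31 ^ 2 = 31 := Real.sq_sqrt (by norm_num)
    have e4 : 0 ≤ A ^ 2 / s * Q := by positivity
    rw [e1, e2, ← one_add_mul, mul_pow, Real.sq_sqrt e4]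
    refine mul_le_mul_of_nonneg_right ?_ e4
    nlinarith
  calc (‖y - f k‖ ^ 2 - ‖y - ∑ i ∈ act, a i • g i‖ ^ 2) ^ 2
      ≤ (2 * (A * √(Q / s) + √(31 * (A ^ 2 / s)) * √Q)) ^ 2 := pow_le_pow_left₀ hpos h3 2
    _ ≤ 200 * (A ^ 2 / s * Q) := by rw [mul_pow]; linarith
    _ ≤ 200 * (A ^ 2 / s * (3 / 2 * (‖y - f k‖ ^ 2 - ‖y - f (k + 1)‖ ^ 2))) := by gcongr
    _ = _ := by ring

/-- The rate of convergence of the orthogonal super greedy algorithm. -/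
theorem norm_sq_le (hrun : IsGreedyRun g act y s m sel f) (hg : IsCoherent g act M)
    (hs : StepSize M s) (hm : 0 < m) (a : ι → ℝ) :
    ‖y - f m‖ ^ 2 ≤ ‖y - ∑ i ∈ act, a i • g i‖ ^ 2 + 300 * (∑ i ∈ act, |a i|) ^ 2 / (s * m) := by
  classical
  have hs0 : (0 : ℝ) < s := by exact_mod_cast hs.one_le
  have hm0 : (0 : ℝ) < m := by exact_mod_cast hm
  set h := ∑ i ∈ act, a i • g i with hh
  set K := 300 * ((∑ i ∈ act, |a i|) ^ 2 / s) with hK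
  have hK0 : 0 ≤ K := by positivity
  have hfirst := hrun.excess_one_add_le hg hs hm a
  have hanti : ∀ k < m, ‖y - f (k + 1)‖ ^ 2 ≤ ‖y - f k‖ ^ 2 := by
    intro k hk
    have h1 := hrun.norm_sq_succ_le hk (v := 0) (by simpa using hrun.mem_span_succ hk.le)
    simpa using h1
  have hcoef : 0 ≤ ∑ i ∈ act \ sel 0, a i ^ 2 := Finset.sum_nonneg fun _ _ => sq_nonneg _
  have key : ∀ k : ℕ, 0 < k → k ≤ m → ‖y - f k‖ ^ 2 - ‖y - h‖ ^ 2 ≤ K / k := by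
    intro k hk0
    induction k, hk0 using Nat.le_induction with
    | base =>
      intro _
      have : 0 ≤ (∑ i ∈ act, |a i|) ^ 2 / s := by positivity
      simp only [Nat.succ_eq_add_one, zero_add, Nat.cast_one, div_one]
      linarith
    | succ k hk ih =>
      intro hkm
      have hk0 : (0 : ℝ) < k := by exact_mod_cast hk
      have ih' := ih (by omega)
      have hd := hanti k (by omega)
      rcases le_or_gt (‖y - f (k + 1)‖ ^ 2 - ‖y - h‖ ^ 2) 0 with h0 | h0
      · exact h0.trans (by positivity)
      -- A positive excess now means a positive excess after the first iteration, so `hfirst` yields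
      -- the coefficient bound required by `excess_sq_le`.
      have hmono : ‖y - f k‖ ^ 2 ≤ ‖y - f 1‖ ^ 2 := by
        have : ∀ j : ℕ, 1 ≤ j → j ≤ m → ‖y - f j‖ ^ 2 ≤ ‖y - f 1‖ ^ 2 := by
          intro j hj
          induction j, hj using Nat.le_induction with
          | base => intro _; exact le_rfl
          | succ j hj ihj => intro hjm; exact (hanti j (by omega)).trans (ihj (by omega))
        exact this k hk (by omega)
      have hsq := hrun.excess_sq_le hg hs a (by linarith) hk (by omega) (by linarith)
      push_cast
      rw [le_div_iff₀ (by positivity)]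
      rw [le_div_iff₀ hk0] at ih'
      set d := ‖y - f k‖ ^ 2 - ‖y - h‖ ^ 2 with hdd
      set e := ‖y - f (k + 1)‖ ^ 2 - ‖y - h‖ ^ 2 with hee
      have h1 : d ^ 2 ≤ K * (d - e) := by
        have : ‖y - f k‖ ^ 2 - ‖y - f (k + 1)‖ ^ 2 = d - e := by rw [hdd, hee]; ring
        rw [← this]; exact hsq
      have hed : e ≤ d := by linarith
      by_contra hcon
      push Not at hcon
      have h2 : K * d < (d * (k + 1)) * d := by
        refine mul_lt_mul_of_pos_right ?_ (by linarith)
        nlinarith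
      nlinarith
  have := key m hm le_rfl
  have e : 300 * (∑ i ∈ act, |a i|) ^ 2 / (s * m) = K / m := by
    rw [hK]; field_simp
  rw [e]; linarith

end IsGreedyRun
end Coherent

/-! ### Finite covers of truncated sparse combinations on finitely many points -/

section Cover

theorem trunc_eq_max_min {L : ℝ} (hL : 0 < L) (t : ℝ) : OSGA.trunc L t = max (-L) (min L t) := by
  unfold OSGA.trunc
  rcases lt_trichotomy t 0 with h | h | h
  · rw [Real.sign_of_neg h, abs_of_neg h, min_eq_right (a := L) (b := t) (by linarith)]
    rcases le_total L (-t) with h' | h'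
    · rw [min_eq_left h', max_eq_left (by linarith)]; ring
    · rw [min_eq_right h', max_eq_right (by linarith)]; ring
  · subst h
    simp [hL.le]
  · rw [Real.sign_of_pos h, abs_of_pos h, mul_one, max_eq_right]
    exact le_min (by linarith) (by linarith)

theorem abs_trunc_le {L : ℝ} (hL : 0 < L) (t : ℝ) : |OSGA.trunc L t| ≤ L := by
  rw [trunc_eq_max_min hL, abs_le]
  exact ⟨le_max_left _ _, max_le (by linarith) (min_le_left _ _)⟩

theorem abs_trunc_sub_le {L : ℝ} (hL : 0 < L) {y : ℝ} (hy : |y| ≤ L) (t : ℝ) :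
    |OSGA.trunc L t - y| ≤ |t - y| := by
  rw [trunc_eq_max_min hL]
  obtain ⟨h1, h2⟩ := abs_le.1 hy
  rcases le_total t L with h | h
  · rw [min_eq_right h]
    rcases le_total (-L) t with h' | h'
    · rw [max_eq_right h']
    · rw [max_eq_left h', abs_of_nonpos (by linarith), abs_of_nonpos (by linarith)]
      linarith
  · rw [min_eq_left h, max_eq_right (by linarith), abs_of_nonneg (by linarith),
      abs_of_nonneg (by linarith)]
    linarith

theorem measurable_trunc {L : ℝ} (hL : 0 < L) : Measurable (OSGA.trunc L) := by
  have : OSGA.trunc L = fun t => max (-L) (min L t) := funext (trunc_eq_max_min hL)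
  rw [this]
  fun_prop

/-- Numbers on the same side of all points of a grid have close truncations. -/
theorem trunc_sub_trunc_le {L : ℝ} (hL : 0 < L) {q : ℕ} (hq : 0 < q) {a b : ℝ}
    (hab : ∀ j : Fin q, -L + j * (2 * L / q) < b → -L + j * (2 * L / q) < a) :
    OSGA.trunc L b - OSGA.trunc L a ≤ 2 * L / q := by
  have hq0 : (0 : ℝ) < q := by exact_mod_cast hq
  have hη : 0 < 2 * L / q := by positivity
  set η := 2 * L / q with hηdef
  have hqη : q * η = 2 * L := by rw [hηdef]; field_simp
  rw [trunc_eq_max_min hL, trunc_eq_max_min hL]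
  by_contra hcon
  push Not at hcon
  set A := max (-L) (min L a) with hA
  set B := max (-L) (min L b) with hB
  have hAL : -L ≤ A := le_max_left _ _
  have hBL : B ≤ L := max_le (by linarith) (min_le_left _ _)
  -- If the truncations differed by more than the mesh, the first grid level at or above `A` would
  -- lie strictly below `b` but not below `a`.
  set j := ⌈(A + L) / η⌉₊ with hj
  have h1 : A + L ≤ j * η := by
    rw [← div_le_iff₀ hη]; exact Nat.le_ceil _
  have h2 : j * η < A + L + η := by
    have := Nat.ceil_lt_add_one (a := (A + L) / η) (div_nonneg (by linarith) hη.le)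
    rw [← hj, ← sub_lt_iff_lt_add, lt_div_iff₀ hη] at this
    linarith
  have hjq : j < q := by
    have : (j : ℝ) * η < q * η := by linarith
    exact_mod_cast lt_of_mul_lt_mul_right this hη.le
  have h3 : -L + j * η < b := by
    have h4 : -L + j * η < B := by linarith
    rcases lt_max_iff.1 h4 with h5 | h5
    · linarith
    · exact h5.trans_le (min_le_right _ _)
  have h6 := hab ⟨j, hjq⟩ h3
  have h7 : -L + j * η < A := lt_max_of_lt_right (lt_min (by linarith) h6)
  linarith

theorem sum_choose_le_pow (n d : ℕ) : ∑ k ∈ Finset.Iic d, n.choose k ≤ (n + 1) ^ d := by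
  rw [add_pow, Nat.range_succ_eq_Iic]
  refine Finset.sum_le_sum fun k hk => ?_
  have hk' : k ≤ d := Finset.mem_Iic.1 hk
  rw [one_pow, mul_one]
  exact (Nat.choose_le_pow n k).trans (Nat.le_mul_of_pos_right _ (Nat.choose_pos hk'))

/-- Positivity sets of an affine family of functions shatter no set larger than its dimension. -/
theorem card_le_of_shatters {V T : Type*} [AddCommGroup V] [Module ℝ V] [FiniteDimensional ℝ V]
    [DecidableEq T] {D : ℕ} (hV : Module.finrank ℝ V ≤ D) (e : T → V →ₗ[ℝ] ℝ) (τ : T → ℝ)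
    (𝒜 : Finset (Finset T)) (h𝒜 : ∀ A ∈ 𝒜, ∃ f : V, ∀ t, t ∈ A ↔ τ t < e t f)
    (S : Finset T) (hS : 𝒜.Shatters S) : S.card ≤ D + 1 := by
  by_contra hcon
  push Not at hcon
  -- The extra coordinate makes the affine functions `e t f - τ t` the values of a linear map at
  -- `(f, 1)`, at the price of one dimension. Its range misses part of `S → ℝ`, so some nonzero
  -- functional kills it.
  let Ψ : (V × ℝ) →ₗ[ℝ] (S → ℝ) :=
    LinearMap.pi fun t => (e t).comp (LinearMap.fst ℝ V ℝ) - τ t • LinearMap.snd ℝ V ℝ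
  have hlt : LinearMap.range Ψ < ⊤ := by
    rw [lt_top_iff_ne_top]
    intro h
    have h1 := LinearMap.finrank_range_le Ψ
    rw [h, finrank_top, Module.finrank_fintype_fun_eq_card, Fintype.card_coe,
      Module.finrank_prod, Module.finrank_self] at h1
    omega
  obtain ⟨ψ, hψ0, hψ⟩ := Submodule.exists_le_ker_of_lt_top _ hlt
  have hsum : ∀ v : S → ℝ, ψ v = ∑ t, v t * ψ (Pi.single t 1) := fun v => by
    conv_lhs => rw [pi_eq_sum_univ' v, map_sum]
    exact Finset.sum_congr rfl fun t _ => by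
      rw [map_smul, smul_eq_mul]
  -- If `S` were shattered, some `f` would be above its threshold exactly where `γ > 0`, making
  -- every term nonnegative and one positive.
  have key : ∀ γ : S → ℝ, (∃ t, 0 < γ t) →
      (∀ f : V, ∑ t : S, (e t f - τ t) * γ t = 0) → False := by
    rintro γ ⟨t₀, ht₀⟩ hγ
    obtain ⟨A, hA, hAS⟩ := hS (t := (Finset.univ.filter fun t : S => 0 < γ t).map
      (Function.Embedding.subtype _)) (by
        intro x hx
        simp only [Finset.mem_map, Function.Embedding.coe_subtype] at hx
        obtain ⟨y, _, rfl⟩ := hx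
        exact y.2)
    obtain ⟨f, hf⟩ := h𝒜 A hA
    have hmem : ∀ t : S, (t : T) ∈ A ↔ 0 < γ t := by
      intro t
      have h1 : (t : T) ∈ S ∩ A ↔ (t : T) ∈ A := by simp
      rw [← h1, hAS]
      simp
    have hpos : 0 < ∑ t : S, (e t f - τ t) * γ t := by
      refine Finset.sum_pos' (fun t _ => ?_) ⟨t₀, Finset.mem_univ _, ?_⟩
      · rcases lt_or_ge 0 (γ t) with h | h
        · have := (hf t).1 ((hmem t).2 h)
          exact mul_nonneg (by linarith) h.le
        · have : ¬ (τ t < e t f) := fun h' => h.not_gt ((hmem t).1 ((hf t).2 h'))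
          exact mul_nonneg_of_nonpos_of_nonpos (by linarith) h
      · have := (hf t₀).1 ((hmem t₀).2 ht₀)
        exact mul_pos (by linarith) ht₀
    exact hpos.ne' (hγ f)
  have hker : ∀ f : V, ∑ t : S, (e t f - τ t) * ψ (Pi.single t 1) = 0 := by
    intro f
    have h1 : ψ (Ψ (f, 1)) = 0 := hψ ⟨(f, 1), rfl⟩
    rw [hsum] at h1
    simpa [Ψ] using h1
  obtain ⟨t, ht⟩ : ∃ t : S, ψ (Pi.single t 1) ≠ 0 := by
    by_contra h
    push Not at h
    exact hψ0 (LinearMap.ext fun v => by rw [hsum]; simp [h])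
  rcases lt_or_gt_of_ne ht with h | h
  · refine key (fun t => -ψ (Pi.single t 1)) ⟨t, by linarith⟩ fun f => ?_
    simp only [mul_neg, Finset.sum_neg_distrib, hker f, neg_zero]
  · exact key _ ⟨t, h⟩ hker

/-- Record which grid levels the values exceed, a subset of `I × Fin q`. Functions with equal
patterns have close truncations, and Sauer–Shelah counts the patterns, so one representative of each
pattern suffices. -/
theorem exists_cover_of_submodule {X I : Type*} [Fintype I] [DecidableEq I]
    (V : Submodule ℝ (X → ℝ)) [FiniteDimensional ℝ V] {D : ℕ} (hV : Module.finrank ℝ V ≤ D)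
    (p : I → X) {L : ℝ} (hL : 0 < L) {q : ℕ} (hq : 0 < q) :
    ∃ C : Finset (I → ℝ), C.card ≤ (Fintype.card I * q + 1) ^ (D + 1) ∧
      (∀ c ∈ C, ∀ i, |c i| ≤ L) ∧
      ∀ f ∈ V, ∃ c ∈ C, ∀ i, |OSGA.trunc L (f (p i)) - c i| ≤ 2 * L / q := by
  classical
  let τ : I × Fin q → ℝ := fun t => -L + t.2 * (2 * L / q)
  let pat : (X → ℝ) → Finset (I × Fin q) := fun f => Finset.univ.filter fun t => τ t < f (p t.1)
  let 𝒜 : Finset (Finset (I × Fin q)) := Finset.univ.filter fun A => ∃ f ∈ V, pat f = A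
  have h𝒜 : ∀ A : 𝒜, ∃ f ∈ V, pat f = A := fun A => (Finset.mem_filter.1 A.2).2
  choose F hFV hF using h𝒜
  refine ⟨𝒜.attach.image fun A i => OSGA.trunc L (F A (p i)), ?_, ?_, ?_⟩
  · refine Finset.card_image_le.trans ?_
    rw [Finset.card_attach]
    refine (Finset.card_le_card_shatterer 𝒜).trans (Finset.card_shatterer_le_sum_vcDim.trans ?_)
    have hvc : 𝒜.vcDim ≤ D + 1 := by
      refine Finset.sup_le fun S hS => ?_
      refine card_le_of_shatters hV
        (fun t => (LinearMap.proj (p t.1)).comp V.subtype) τ 𝒜 ?_ S (Finset.mem_shatterer.1 hS)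
      intro A hA
      obtain ⟨f, hfV, rfl⟩ := (Finset.mem_filter.1 hA).2
      exact ⟨⟨f, hfV⟩, fun t => by simp [pat]⟩
    refine (sum_choose_le_pow _ _).trans ?_
    rw [Fintype.card_prod, Fintype.card_fin]
    exact Nat.pow_le_pow_right (Nat.succ_pos _) hvc
  · intro c hc i
    obtain ⟨A, _, rfl⟩ := Finset.mem_image.1 hc
    exact abs_trunc_le hL _
  · intro f hf
    have hA : pat f ∈ 𝒜 := Finset.mem_filter.2 ⟨Finset.mem_univ _, f, hf, rfl⟩
    refine ⟨_, Finset.mem_image_of_mem _ (Finset.mem_attach _ ⟨pat f, hA⟩), fun i => ?_⟩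
    have hpat : ∀ j : Fin q, -L + j * (2 * L / q) < f (p i) ↔
        -L + j * (2 * L / q) < F ⟨pat f, hA⟩ (p i) := by
      intro j
      have h1 := Finset.ext_iff.1 (hF ⟨pat f, hA⟩) (i, j)
      simpa [pat, τ] using h1.symm
    rw [abs_sub_le_iff]
    exact ⟨trunc_sub_trunc_le hL hq fun j => (hpat j).1,
      trunc_sub_trunc_le hL hq fun j => (hpat j).2⟩

/-- A cover of the truncated functions that are combinations of few elements of a dictionary. -/
theorem exists_cover {X I : Type*} [Fintype I] [DecidableEq I] {N : ℕ} (hN : 0 < N)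
    (φ : Fin N → X → ℝ) (D : ℕ) (p : I → X) {L : ℝ} (hL : 0 < L) {q : ℕ} (hq : 0 < q) :
    ∃ C : Finset (I → ℝ), C.card ≤ N ^ D * (Fintype.card I * q + 1) ^ (D + 1) ∧
      (∀ c ∈ C, ∀ i, |c i| ≤ L) ∧
      ∀ Λ : Finset (Fin N), Λ.card ≤ D → ∀ f ∈ Submodule.span ℝ (φ '' Λ),
        ∃ c ∈ C, ∀ i, |OSGA.trunc L (f (p i)) - c i| ≤ 2 * L / q := by
  classical
  have h (Λ : Finset (Fin N)) : ∃ C : Finset (I → ℝ), Λ.card ≤ D →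
      C.card ≤ (Fintype.card I * q + 1) ^ (D + 1) ∧ (∀ c ∈ C, ∀ i, |c i| ≤ L) ∧
      ∀ f ∈ Submodule.span ℝ (φ '' Λ), ∃ c ∈ C, ∀ i,
        |OSGA.trunc L (f (p i)) - c i| ≤ 2 * L / q := by
    by_cases hΛ : Λ.card ≤ D
    · have hfin : (φ '' (Λ : Set (Fin N))).Finite := (Finset.finite_toSet Λ).image φ
      have := FiniteDimensional.span_of_finite ℝ hfin
      have hrank : Module.finrank ℝ (Submodule.span ℝ (φ '' (Λ : Set (Fin N)))) ≤ D := by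
        rw [← Finset.coe_image]
        exact (finrank_span_finset_le_card _).trans (Finset.card_image_le.trans hΛ)
      obtain ⟨C, hC⟩ := exists_cover_of_submodule _ hrank p hL hq
      exact ⟨C, fun _ => hC⟩
    · exact ⟨∅, fun h => absurd h hΛ⟩
  choose C hC using h
  have hmin : min D N ≤ D := min_le_left _ _
  -- Smaller index sets can be enlarged, so only those of maximal size are needed; there are at most
  -- `N ^ D` of them.
  refine ⟨(Finset.univ.powersetCard (min D N)).biUnion C, ?_, ?_, ?_⟩
  · refine (Finset.card_biUnion_le_card_mul _ _ ((Fintype.card I * q + 1) ^ (D + 1)) ?_).trans ?_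
    · intro Λ hΛ
      exact (hC Λ ((Finset.mem_powersetCard.1 hΛ).2.trans_le hmin)).1
    · refine Nat.mul_le_mul_right _ ?_
      rw [Finset.card_powersetCard, Finset.card_univ, Fintype.card_fin]
      exact (Nat.choose_le_pow _ _).trans (Nat.pow_le_pow_right hN hmin)
  · intro c hc i
    obtain ⟨Λ, hΛ, hcΛ⟩ := Finset.mem_biUnion.1 hc
    exact (hC Λ ((Finset.mem_powersetCard.1 hΛ).2.trans_le hmin)).2.1 c hcΛ i
  · intro Λ hΛ f hf
    obtain ⟨Λ', hsub, hcard⟩ := Finset.exists_superset_card_eq (s := Λ) (n := min D N)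
      (le_min hΛ (by simpa using Finset.card_le_univ Λ)) (by simp)
    obtain ⟨c, hc, hcf⟩ := (hC Λ' (hcard.trans_le hmin)).2.2 f
      (Submodule.span_mono (Set.image_mono (by exact_mod_cast hsub)) hf)
    refine ⟨c, Finset.mem_biUnion.2 ⟨Λ', ?_, hc⟩, hcf⟩
    exact Finset.mem_powersetCard.2 ⟨Finset.subset_univ _, hcard⟩

end Cover

/-! ### Exponential moments under random swaps of sample and ghost points -/

section Swap

/-- The contribution of a sample point and a ghost point to the deviation between the risk and
four times the empirical excess risk; `a`, `f`, `y` are the values of the estimator, the regression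
function and the output at the sample point, and `a'`, `f'`, `y'` those at the ghost point. -/
def pairDeviation (a f y a' f' y' : ℝ) : ℝ :=
  (a' - f') ^ 2 - 4 * (a - f) ^ 2 + 8 * ((a - f) * (y - f) - (a' - f') * (y' - f'))

theorem sq_sub_le {L a f : ℝ} (ha : |a| ≤ L) (hf : |f| ≤ L) : (a - f) ^ 2 ≤ 4 * L ^ 2 := by
  have h := (abs_sub a f).trans (add_le_add ha hf)
  rw [← sq_abs]
  nlinarith [abs_nonneg (a - f)]

theorem sq_fluctuation_le {K u u' w w' : ℝ} (hu0 : 0 ≤ u) (hu'0 : 0 ≤ u') (hu : u ≤ K)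
    (hu' : u' ≤ K) (hw : w ^ 2 ≤ u * K) (hw' : w' ^ 2 ≤ u' * K) :
    (5 / 2 * (u' - u) + 8 * (w - w')) ^ 2 ≤ 537 / 2 * K * (u + u') := by
  have h1 := mul_le_mul_of_nonneg_left hu hu0
  have h2 := mul_le_mul_of_nonneg_left hu' hu'0
  have h3 := mul_nonneg hu0 hu'0
  have h4 : (u' - u) ^ 2 ≤ K * (u + u') := by linarith
  have h5 : (w - w') ^ 2 ≤ 2 * K * (u + u') := by linarith [sq_nonneg (w + w')]
  have h6 : (5 / 2 * (u' - u) + 8 * (w - w')) ^ 2 ≤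
      25 / 2 * (u' - u) ^ 2 + 128 * (w - w') ^ 2 := by
    linarith [sq_nonneg (5 / 2 * (u' - u) - 8 * (w - w'))]
  linarith

/-- The deviation is `Z - 3/2 * (u + u')` with `Z` odd and `u + u'` even under the swap. Since `Z ^
2 ≲ L ^ 2 * (u + u')`, for a small multiplier the drift absorbs the factor `cosh (lam * Z) ≤ exp
((lam * Z) ^ 2 / 2)`. This needs `1074 / 2 ≤ 3/2 * 400`. -/
theorem exp_pairDeviation_add_le {L a f y a' f' y' : ℝ} (hL : 0 < L) (ha : |a| ≤ L)
    (hf : |f| ≤ L) (hy : |y| ≤ L) (ha' : |a'| ≤ L) (hf' : |f'| ≤ L) (hy' : |y'| ≤ L) :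
    Real.exp (pairDeviation a f y a' f' y' / (400 * L ^ 2)) +
      Real.exp (pairDeviation a' f' y' a f y / (400 * L ^ 2)) ≤ 2 := by
  set u := (a - f) ^ 2 with hu
  set u' := (a' - f') ^ 2 with hu'
  set w := (a - f) * (y - f) with hw
  set w' := (a' - f') * (y' - f') with hw'
  set Z := 5 / 2 * (u' - u) + 8 * (w - w') with hZ
  have hu0 : 0 ≤ u := sq_nonneg _
  have hu'0 : 0 ≤ u' := sq_nonneg _
  have huL : u ≤ 4 * L ^ 2 := sq_sub_le ha hf
  have hu'L : u' ≤ 4 * L ^ 2 := sq_sub_le ha' hf'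
  have hwL : w ^ 2 ≤ u * (4 * L ^ 2) := by
    rw [hw, mul_pow]; exact mul_le_mul_of_nonneg_left (sq_sub_le hy hf) hu0
  have hw'L : w' ^ 2 ≤ u' * (4 * L ^ 2) := by
    rw [hw', mul_pow]; exact mul_le_mul_of_nonneg_left (sq_sub_le hy' hf') hu'0
  have hZ2 : Z ^ 2 ≤ 1074 * L ^ 2 * (u + u') := by
    have := sq_fluctuation_le hu0 hu'0 huL hu'L hwL hw'L
    calc Z ^ 2 ≤ 537 / 2 * (4 * L ^ 2) * (u + u') := this
      _ = _ := by ring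
  set lam := 1 / (400 * L ^ 2) with hlam
  have hlam0 : 0 < lam := by positivity
  have e1 : pairDeviation a f y a' f' y' / (400 * L ^ 2) =
      lam * Z + -(3 / 2 * lam * (u + u')) := by
    unfold pairDeviation; rw [hlam, hZ]; ring
  have e2 : pairDeviation a' f' y' a f y / (400 * L ^ 2) =
      -(lam * Z) + -(3 / 2 * lam * (u + u')) := by
    unfold pairDeviation; rw [hlam, hZ]; ring
  rw [e1, e2, Real.exp_add, Real.exp_add, ← add_mul]
  have h4 : Real.exp (lam * Z) + Real.exp (-(lam * Z)) = 2 * Real.cosh (lam * Z) := by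
    rw [Real.cosh_eq]; ring
  rw [h4]
  have h5 : (lam * Z) ^ 2 / 2 ≤ 3 / 2 * lam * (u + u') := by
    have h6 : lam * L ^ 2 = 1 / 400 := by rw [hlam]; field_simp
    calc (lam * Z) ^ 2 / 2 = lam * (lam * Z ^ 2 / 2) := by ring
      _ ≤ lam * (lam * (1074 * L ^ 2 * (u + u')) / 2) := by gcongr
      _ = lam * L ^ 2 * 537 * (lam * (u + u')) := by ring
      _ = 537 / 400 * (lam * (u + u')) := by rw [h6]; ring
      _ ≤ 3 / 2 * (lam * (u + u')) := by
          refine mul_le_mul_of_nonneg_right (by norm_num) (by positivity)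
      _ = _ := by ring
  calc 2 * Real.cosh (lam * Z) * Real.exp (-(3 / 2 * lam * (u + u')))
      ≤ 2 * Real.exp (3 / 2 * lam * (u + u')) * Real.exp (-(3 / 2 * lam * (u + u'))) := by
        gcongr
        exact (Real.cosh_le_exp_half_sq _).trans (Real.exp_le_exp.2 h5)
    _ = 2 := by rw [mul_assoc, ← Real.exp_add]; simp

/-- Price of replacing the estimator by an element of the cover: `52 = 4 + 4 * 4 + 8 * (2 + 2)`. -/
theorem pairDeviation_sub_le {L η a f y a' f' y' c c' : ℝ} (ha : |a| ≤ L) (hf : |f| ≤ L)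
    (hy : |y| ≤ L) (ha' : |a'| ≤ L) (hf' : |f'| ≤ L) (hy' : |y'| ≤ L) (hc : |c| ≤ L)
    (hc' : |c'| ≤ L) (hac : |a - c| ≤ η) (hac' : |a' - c'| ≤ η) :
    pairDeviation a f y a' f' y' - pairDeviation c f y c' f' y' ≤ 52 * L * η := by
  have hη : 0 ≤ η := (abs_nonneg _).trans hac
  have hsq : ∀ {a c f : ℝ}, |a| ≤ L → |c| ≤ L → |f| ≤ L → |a - c| ≤ η →
      |(a - f) ^ 2 - (c - f) ^ 2| ≤ η * (4 * L) := by
    intro a c f ha hc hf hac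
    have e : (a - f) ^ 2 - (c - f) ^ 2 = (a - c) * (a + c - 2 * f) := by ring
    rw [e, abs_mul]
    refine mul_le_mul hac ?_ (abs_nonneg _) hη
    rw [abs_le] at *
    constructor <;> linarith [ha.1, ha.2, hc.1, hc.2, hf.1, hf.2]
  have hlin : ∀ {a c f y : ℝ}, |y| ≤ L → |f| ≤ L → |a - c| ≤ η →
      |(a - f) * (y - f) - (c - f) * (y - f)| ≤ η * (2 * L) := by
    intro a c f y hy hf hac
    have e : (a - f) * (y - f) - (c - f) * (y - f) = (a - c) * (y - f) := by ring
    rw [e, abs_mul]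
    refine mul_le_mul hac ?_ (abs_nonneg _) hη
    rw [abs_le] at *
    constructor <;> linarith [hy.1, hy.2, hf.1, hf.2]
  have h1 := abs_le.1 (hsq ha hc hf hac)
  have h2 := abs_le.1 (hsq ha' hc' hf' hac')
  have h3 := abs_le.1 (hlin hy hf hac)
  have h4 := abs_le.1 (hlin hy' hf' hac')
  unfold pairDeviation
  linarith [h1.1, h2.2, h3.2, h4.1]

/-- For a fixed `c` the swaps act independently, so the sum factorizes over the indices. -/
theorem sum_exp_pairDeviation_le {n : ℕ} {L : ℝ} (hL : 0 < L) (c f y : Fin n × Bool → ℝ)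
    (hc : ∀ p, |c p| ≤ L) (hf : ∀ p, |f p| ≤ L) (hy : ∀ p, |y p| ≤ L) :
    ∑ σ : Fin n → Bool, Real.exp ((∑ i, pairDeviation (c (i, σ i)) (f (i, σ i)) (y (i, σ i))
      (c (i, !σ i)) (f (i, !σ i)) (y (i, !σ i))) / (400 * L ^ 2)) ≤ 2 ^ n := by
  have h1 : ∀ σ : Fin n → Bool, Real.exp ((∑ i, pairDeviation (c (i, σ i)) (f (i, σ i))
      (y (i, σ i)) (c (i, !σ i)) (f (i, !σ i)) (y (i, !σ i))) / (400 * L ^ 2)) =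
      ∏ i, Real.exp (pairDeviation (c (i, σ i)) (f (i, σ i)) (y (i, σ i))
        (c (i, !σ i)) (f (i, !σ i)) (y (i, !σ i)) / (400 * L ^ 2)) := by
    intro σ
    rw [Finset.sum_div, Real.exp_sum]
  simp_rw [h1]
  have h2 := Finset.prod_univ_sum (fun _ : Fin n => (Finset.univ : Finset Bool))
    (fun i b => Real.exp (pairDeviation (c (i, b)) (f (i, b)) (y (i, b))
        (c (i, !b)) (f (i, !b)) (y (i, !b)) / (400 * L ^ 2)))
  rw [Fintype.piFinset_univ] at h2
  rw [← h2]
  calc _ ≤ ∏ _i : Fin n, (2 : ℝ) := by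
        refine Finset.prod_le_prod (fun i _ => Finset.sum_nonneg fun b _ => (Real.exp_pos _).le)
          fun i _ => ?_
        rw [Fintype.sum_bool]
        exact exp_pairDeviation_add_le hL (hc _) (hf _) (hy _) (hc _) (hf _) (hy _)
    _ = 2 ^ n := by simp

/-- The average over all swaps of sample and ghost points of the deviation, for an estimator that
may depend on the swap but is covered by the finite set `C`. -/
theorem sum_pairDeviation_le {n : ℕ} {L η : ℝ} (hL : 0 < L) (f y : Fin n × Bool → ℝ)
    (hf : ∀ p, |f p| ≤ L) (hy : ∀ p, |y p| ≤ L) (C : Finset (Fin n × Bool → ℝ))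
    (hC : ∀ c ∈ C, ∀ p, |c p| ≤ L) (a : (Fin n → Bool) → Fin n × Bool → ℝ)
    (ha : ∀ σ p, |a σ p| ≤ L) (haC : ∀ σ, ∃ c ∈ C, ∀ p, |a σ p - c p| ≤ η) :
    ∑ σ : Fin n → Bool, ∑ i, pairDeviation (a σ (i, σ i)) (f (i, σ i)) (y (i, σ i))
      (a σ (i, !σ i)) (f (i, !σ i)) (y (i, !σ i)) ≤
      2 ^ n * (400 * L ^ 2 * Real.log C.card + n * (52 * L * η)) := by
  choose b hbC hb using haC
  have hCpos : 0 < (C.card : ℝ) := by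
    exact_mod_cast Finset.card_pos.2 ⟨_, hbC fun _ => false⟩
  let T : (Fin n × Bool → ℝ) → (Fin n → Bool) → ℝ := fun c σ =>
    ∑ i, pairDeviation (c (i, σ i)) (f (i, σ i)) (y (i, σ i))
      (c (i, !σ i)) (f (i, !σ i)) (y (i, !σ i))
  have hT : ∀ σ, T (a σ) σ ≤ T (b σ) σ + n * (52 * L * η) := by
    intro σ
    have : T (a σ) σ - T (b σ) σ ≤ ∑ _i : Fin n, 52 * L * η := by
      rw [← Finset.sum_sub_distrib]
      exact Finset.sum_le_sum fun i _ => pairDeviation_sub_le (ha _ _) (hf _) (hy _) (ha _ _)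
        (hf _) (hy _) (hC _ (hbC σ) _) (hC _ (hbC σ) _) (hb σ _) (hb σ _)
    simp only [Finset.sum_const, Finset.card_univ, Fintype.card_fin, nsmul_eq_mul] at this
    linarith
  -- The element `b σ` depends on the swap, so its exponential is bounded by the sum over `C`. The
  -- tangent inequality `x ≤ log K + exp x / K - 1` takes the place of Jensen.
  have hlog : ∀ σ, T (b σ) σ ≤ 400 * L ^ 2 * (Real.log C.card +
      ((∑ c ∈ C, Real.exp (T c σ / (400 * L ^ 2))) / C.card - 1)) := by
    intro σ
    have h1 : Real.exp (T (b σ) σ / (400 * L ^ 2)) ≤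
        ∑ c ∈ C, Real.exp (T c σ / (400 * L ^ 2)) :=
      Finset.single_le_sum (f := fun c => Real.exp (T c σ / (400 * L ^ 2)))
        (fun c _ => (Real.exp_pos _).le) (hbC σ)
    have h2 := Real.add_one_le_exp (T (b σ) σ / (400 * L ^ 2) - Real.log C.card)
    rw [Real.exp_sub, Real.exp_log hCpos] at h2
    have h3 := div_le_div_of_nonneg_right h1 hCpos.le
    rw [← div_le_iff₀' (by positivity)]
    linarith
  have hmgf : ∑ σ : Fin n → Bool, ∑ c ∈ C, Real.exp (T c σ / (400 * L ^ 2)) ≤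
      C.card * 2 ^ n := by
    rw [Finset.sum_comm, ← nsmul_eq_mul]
    exact Finset.sum_le_card_nsmul _ _ _ fun c hc =>
      sum_exp_pairDeviation_le hL c f y (hC c hc) hf hy
  have hcard : ((Finset.univ : Finset (Fin n → Bool)).card : ℝ) = 2 ^ n := by simp
  calc ∑ σ : Fin n → Bool, T (a σ) σ
      ≤ ∑ σ : Fin n → Bool, (400 * L ^ 2 * (Real.log C.card +
        ((∑ c ∈ C, Real.exp (T c σ / (400 * L ^ 2))) / C.card - 1)) + n * (52 * L * η)) :=
        Finset.sum_le_sum fun σ _ => (hT σ).trans (by linarith [hlog σ])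
    _ = 2 ^ n * (400 * L ^ 2 * (Real.log C.card - 1) + n * (52 * L * η)) + 400 * L ^ 2 *
        ((∑ σ : Fin n → Bool, ∑ c ∈ C, Real.exp (T c σ / (400 * L ^ 2))) / C.card) := by
        rw [Finset.sum_add_distrib, ← Finset.mul_sum, Finset.sum_add_distrib,
          Finset.sum_sub_distrib, ← Finset.sum_div]
        simp only [Finset.sum_const, nsmul_eq_mul, hcard]
        ring
    _ ≤ 2 ^ n * (400 * L ^ 2 * (Real.log C.card - 1) + n * (52 * L * η)) + 400 * L ^ 2 *
        2 ^ n := by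
        gcongr
        rw [div_le_iff₀' hCpos]
        exact hmgf
    _ = _ := by ring

end Swap

/-! ### The regression function as conditional mean -/

section Regression

variable {X : Type u} [MeasurableSpace X] {ρ : Measure (X × ℝ)} [IsProbabilityMeasure ρ] {L : ℝ}

theorem measurable_regression : Measurable (OSGA.regression ρ) :=
  (StronglyMeasurable.integral_kernel (κ := ρ.condKernel) stronglyMeasurable_id).measurable

theorem abs_regression_le (hy : ∀ᵐ p ∂ρ, |p.2| ≤ L) :
    ∀ᵐ p ∂ρ, |OSGA.regression ρ p.1| ≤ L := by
  have h1 : ∀ᵐ x ∂ρ.fst, |OSGA.regression ρ x| ≤ L := by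
    rw [← ρ.disintegrate ρ.condKernel] at hy
    filter_upwards [Measure.ae_ae_of_ae_compProd hy] with x hx
    have := norm_integral_le_of_norm_le_const (μ := ρ.condKernel x) (f := fun y : ℝ => y) (C := L)
      (by simpa using hx)
    simpa [OSGA.regression] using this
  exact ae_of_ae_map measurable_fst.aemeasurable h1

/-- Disintegrate `ρ`: given `x`, the noise has mean zero while `g x` is constant. -/
theorem integral_mul_sub_regression (hy : ∀ᵐ p ∂ρ, |p.2| ≤ L) {g : X → ℝ}
    (hgi : Integrable (fun p : X × ℝ => g p.1) ρ) :
    ∫ p, g p.1 * (p.2 - OSGA.regression ρ p.1) ∂ρ = 0 := by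
  have hreg := abs_regression_le hy
  have hmeas := measurable_regression (ρ := ρ)
  have hint : Integrable (fun p : X × ℝ => g p.1 * (p.2 - OSGA.regression ρ p.1)) ρ := by
    refine hgi.mul_bdd (c := L + L) (by fun_prop) ?_
    filter_upwards [hy, hreg] with p h1 h2
    exact (abs_sub _ _).trans (add_le_add h1 h2)
  have hint' : Integrable (fun p : X × ℝ => g p.1 * (p.2 - OSGA.regression ρ p.1))
      (ρ.fst ⊗ₘ ρ.condKernel) := by rwa [ρ.disintegrate]
  have heq := Measure.integral_compProd hint'
  rw [ρ.disintegrate] at heq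
  rw [heq]
  refine integral_eq_zero_of_ae ?_
  have hy' : ∀ᵐ p ∂(ρ.fst ⊗ₘ ρ.condKernel), |p.2| ≤ L := by rwa [ρ.disintegrate]
  filter_upwards [Measure.ae_ae_of_ae_compProd hy'] with x hx
  have hid : Integrable (fun y : ℝ => y) (ρ.condKernel x) :=
    Integrable.of_bound (by fun_prop) L hx
  rw [integral_const_mul, integral_sub hid (integrable_const _)]
  simp [OSGA.regression]

end Regression

/-! ### Sample, ghost sample and their exchange -/

section Symmetrization

variable {Z : Type*} [MeasurableSpace Z] {ρ : Measure Z} [IsProbabilityMeasure ρ] {n : ℕ}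

/-- The first or the second of two points at the index `p.1`. -/
def pick (ω : Fin n → Z × Z) (p : Fin n × Bool) : Z :=
  bif p.2 then (ω p.1).2 else (ω p.1).1

/-- Exchange of the sample and the ghost points at the indices where `σ` holds. -/
def swapAt (σ : Fin n → Bool) (ω : Fin n → Z × Z) : Fin n → Z × Z :=
  fun i => (pick ω (i, σ i), pick ω (i, !σ i))

theorem measurePreserving_swapAt (σ : Fin n → Bool) :
    MeasurePreserving (swapAt (Z := Z) σ) (Measure.pi fun _ => ρ.prod ρ)
      (Measure.pi fun _ => ρ.prod ρ) := by
  have h : ∀ i : Fin n, MeasurePreserving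
      (fun p : Z × Z => (bif σ i then p.2 else p.1, bif !σ i then p.2 else p.1))
      (ρ.prod ρ) (ρ.prod ρ) := by
    intro i
    cases σ i
    · exact MeasurePreserving.id _
    · exact Measure.measurePreserving_swap
  exact measurePreserving_pi (fun _ : Fin n => ρ.prod ρ) (fun _ : Fin n => ρ.prod ρ) h

theorem measurePreserving_sample :
    MeasurePreserving (fun (ω : Fin n → Z × Z) i => (ω i).1) (Measure.pi fun _ => ρ.prod ρ)
      (Measure.pi fun _ => ρ) :=
  measurePreserving_pi (fun _ : Fin n => ρ.prod ρ) (fun _ : Fin n => ρ)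
    (fun _ => measurePreserving_fst)

/-- Each ghost point is independent of the whole sample, and hence of the estimator. -/
theorem measurePreserving_sample_ghost (i : Fin n) :
    MeasurePreserving (fun ω : Fin n → Z × Z => ((fun j => (ω j).1), (ω i).2))
      (Measure.pi fun _ => ρ.prod ρ) ((Measure.pi fun _ => ρ).prod ρ) :=
  ((MeasurePreserving.id _).prod (measurePreserving_eval (fun _ : Fin n => ρ) i)).comp
    (measurePreserving_arrowProdEquivProdArrow Z Z (Fin n) (fun _ => ρ) (fun _ => ρ))

theorem ae_pi_of_ae {P : Z → Prop} (h : ∀ᵐ z ∂ρ, P z) :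
    ∀ᵐ z ∂(Measure.pi fun _ : Fin n => ρ), ∀ i, P (z i) :=
  ae_all_iff.2 fun i => (measurePreserving_eval (fun _ : Fin n => ρ) i).quasiMeasurePreserving.ae h

theorem ae_pick_of_ae {P : Z → Prop} (h : ∀ᵐ z ∂ρ, P z) :
    ∀ᵐ ω ∂(Measure.pi fun _ : Fin n => ρ.prod ρ), ∀ p, P (pick ω p) := by
  refine ae_all_iff.2 fun p => ?_
  have h1 := (measurePreserving_eval (fun _ : Fin n => ρ.prod ρ) p.1).quasiMeasurePreserving
  rcases p with ⟨i, b⟩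
  cases b
  · exact h1.ae (Measure.quasiMeasurePreserving_fst.ae h)
  · exact h1.ae (Measure.quasiMeasurePreserving_snd.ae h)

end Symmetrization

/-! ### From empirical excess risk to risk -/

section Deviation

variable {X : Type u} {L : ℝ} {n : ℕ}

/-- The pair deviation of the estimator `G` fitted to `z` at two points. -/
def estDeviation (f : X → ℝ) (G : (Fin n → X × ℝ) → X → ℝ) (z : Fin n → X × ℝ)
    (p p' : X × ℝ) : ℝ :=
  pairDeviation (G z p.1) (f p.1) p.2 (G z p'.1) (f p'.1) p'.2

theorem sum_estDeviation_swapAt_le (hL : 0 < L) {f : X → ℝ} {G : (Fin n → X × ℝ) → X → ℝ}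
    (hGL : ∀ z x, |G z x| ≤ L) {good : Set (Fin n → X × ℝ)} {K : ℕ} {η : ℝ}
    (hcover : ∀ p : Fin n × Bool → X, ∃ C : Finset (Fin n × Bool → ℝ), C.card ≤ K ∧
      (∀ c ∈ C, ∀ i, |c i| ≤ L) ∧ ∀ z ∈ good, ∃ c ∈ C, ∀ i, |G z (p i) - c i| ≤ η)
    (ω : Fin n → (X × ℝ) × (X × ℝ)) (hy : ∀ p, |(pick ω p).2| ≤ L)
    (hf : ∀ p, |f (pick ω p).1| ≤ L)
    (hgood : ∀ σ, (fun i => (swapAt σ ω i).1) ∈ good) :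
    ∑ σ : Fin n → Bool, ∑ i, estDeviation f G (fun i => (swapAt σ ω i).1)
      (swapAt σ ω i).1 (swapAt σ ω i).2 ≤
      2 ^ n * (400 * L ^ 2 * Real.log K + n * (52 * L * η)) := by
  -- Swaps only permute the `2n` points, so one cover serves the estimators fitted to all swapped
  -- samples.
  obtain ⟨C, hCK, hCL, hC⟩ := hcover fun p => (pick ω p).1
  have h := sum_pairDeviation_le hL (fun p => f (pick ω p).1) (fun p => (pick ω p).2) hf hy C hCL
    (fun σ p => G (fun i => (swapAt σ ω i).1) (pick ω p).1) (fun σ p => hGL _ _)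
    (fun σ => hC _ (hgood σ))
  refine h.trans ?_
  have hcard : 0 < C.card := by
    obtain ⟨c, hc, _⟩ := hC _ (hgood fun _ => false)
    exact Finset.card_pos.2 ⟨c, hc⟩
  have hlog : Real.log C.card ≤ Real.log K :=
    Real.log_le_log (by exact_mod_cast hcard) (by exact_mod_cast hCK)
  gcongr

variable [MeasurableSpace X] {ρ : Measure (X × ℝ)} [IsProbabilityMeasure ρ]

/-- The law of the pairs is invariant under each swap, so the integrand may be averaged over all
swaps and bounded pointwise. -/
theorem integral_sum_estDeviation_le (hL : 0 < L) (hy : ∀ᵐ p ∂ρ, |p.2| ≤ L) {f : X → ℝ}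
    (hf : ∀ᵐ p ∂ρ, |f p.1| ≤ L) {G : (Fin n → X × ℝ) → X → ℝ}
    (hGL : ∀ z x, |G z x| ≤ L) {good : Set (Fin n → X × ℝ)}
    (hgood : ∀ᵐ z ∂(Measure.pi fun _ : Fin n => ρ), z ∈ good) {K : ℕ} {η : ℝ}
    (hcover : ∀ p : Fin n × Bool → X, ∃ C : Finset (Fin n × Bool → ℝ), C.card ≤ K ∧
      (∀ c ∈ C, ∀ i, |c i| ≤ L) ∧ ∀ z ∈ good, ∃ c ∈ C, ∀ i, |G z (p i) - c i| ≤ η)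
    (hint : Integrable (fun ω : Fin n → (X × ℝ) × (X × ℝ) =>
      ∑ i, estDeviation f G (fun i => (ω i).1) (ω i).1 (ω i).2)
      (Measure.pi fun _ => ρ.prod ρ)) :
    ∫ ω : Fin n → (X × ℝ) × (X × ℝ), ∑ i, estDeviation f G (fun i => (ω i).1) (ω i).1 (ω i).2
      ∂(Measure.pi fun _ => ρ.prod ρ) ≤ 400 * L ^ 2 * Real.log K + n * (52 * L * η) := by
  set P : Measure (Fin n → (X × ℝ) × (X × ℝ)) := Measure.pi fun _ => ρ.prod ρ with hP
  set Ψ : (Fin n → (X × ℝ) × (X × ℝ)) → ℝ := fun ω =>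
    ∑ i, estDeviation f G (fun i => (ω i).1) (ω i).1 (ω i).2 with hΨ
  have hswap : ∀ σ, ∫ ω, Ψ (swapAt σ ω) ∂P = ∫ ω, Ψ ω ∂P := by
    intro σ
    have hmp := measurePreserving_swapAt (ρ := ρ) σ
    have h1 : AEStronglyMeasurable Ψ (Measure.map (swapAt σ) P) := by
      rw [hP, hmp.map_eq]; exact hint.aestronglyMeasurable
    rw [← integral_map hmp.measurable.aemeasurable h1, hP, hmp.map_eq]
  have hswapint : ∀ σ, Integrable (fun ω => Ψ (swapAt σ ω)) P := fun σ =>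
    ((measurePreserving_swapAt (ρ := ρ) σ).integrable_comp hint.aestronglyMeasurable).2 hint
  have hsum : ∫ ω, ∑ σ : Fin n → Bool, Ψ (swapAt σ ω) ∂P = 2 ^ n * ∫ ω, Ψ ω ∂P := by
    rw [integral_finsetSum _ fun σ _ => hswapint σ, Finset.sum_congr rfl fun σ _ => hswap σ]
    simp
  have hae : ∀ᵐ ω ∂P, ∀ σ, (fun i => (swapAt σ ω i).1) ∈ good :=
    ae_all_iff.2 fun σ => ((measurePreserving_sample (ρ := ρ)).comp
      (measurePreserving_swapAt (ρ := ρ) σ)).quasiMeasurePreserving.ae hgood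
  have hle : ∫ ω, ∑ σ : Fin n → Bool, Ψ (swapAt σ ω) ∂P ≤
      ∫ _, 2 ^ n * (400 * L ^ 2 * Real.log K + n * (52 * L * η)) ∂P := by
    refine integral_mono_ae (integrable_finsetSum _ fun σ _ => hswapint σ)
      (integrable_const _) ?_
    filter_upwards [hae, ae_pick_of_ae (n := n) hy, ae_pick_of_ae (n := n) hf] with ω h1 h2 h3
    exact sum_estDeviation_swapAt_le hL hGL hcover ω h2 h3 h1
  rw [hsum, integral_const, probReal_univ, one_smul] at hle
  exact le_of_mul_le_mul_left hle (by positivity)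

theorem abs_sq_le_of_abs_le {a f : ℝ} (ha : |a| ≤ L) (hf : |f| ≤ L) :
    |(a - f) ^ 2| ≤ 4 * L ^ 2 := by
  rw [abs_of_nonneg (sq_nonneg _)]; exact sq_sub_le ha hf

theorem abs_mul_sub_le {a f y : ℝ} (ha : |a| ≤ L) (hf : |f| ≤ L) (hy : |y| ≤ L) :
    |(a - f) * (y - f)| ≤ 4 * L ^ 2 := by
  have h1 := (abs_sub a f).trans (add_le_add ha hf)
  have h2 := (abs_sub y f).trans (add_le_add hy hf)
  rw [abs_mul]
  nlinarith [abs_nonneg (a - f), abs_nonneg (y - f)]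

/-- The risk of a bounded estimator from a class with finite covers on samples is controlled by
its empirical excess risk. -/
theorem integral_risk_le (hL : 0 < L) (hy : ∀ᵐ p ∂ρ, |p.2| ≤ L)
    {G : (Fin n → X × ℝ) → X → ℝ} (hG : Measurable (Function.uncurry G))
    (hGL : ∀ z x, |G z x| ≤ L) {good : Set (Fin n → X × ℝ)}
    (hgood : ∀ᵐ z ∂(Measure.pi fun _ : Fin n => ρ), z ∈ good) {K : ℕ} {η : ℝ}
    (hcover : ∀ p : Fin n × Bool → X, ∃ C : Finset (Fin n × Bool → ℝ), C.card ≤ K ∧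
      (∀ c ∈ C, ∀ i, |c i| ≤ L) ∧ ∀ z ∈ good, ∃ c ∈ C, ∀ i, |G z (p i) - c i| ≤ η)
    {W : (Fin n → X × ℝ) → ℝ} (hW : Integrable W (Measure.pi fun _ : Fin n => ρ))
    (hGW : ∀ᵐ z ∂(Measure.pi fun _ : Fin n => ρ), ∑ i, ((G z (z i).1 - (z i).2) ^ 2 -
      (OSGA.regression ρ (z i).1 - (z i).2) ^ 2) ≤ W z) :
    n * ∫ z, ∫ p, (G z p.1 - OSGA.regression ρ p.1) ^ 2 ∂ρ ∂(Measure.pi fun _ : Fin n => ρ) ≤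
      4 * ∫ z, W z ∂(Measure.pi fun _ : Fin n => ρ) +
      (400 * L ^ 2 * Real.log K + n * (52 * L * η)) := by
  set f := OSGA.regression ρ with hfdef
  have hf := abs_regression_le hy
  rw [← hfdef] at hf
  have hfm : Measurable f := measurable_regression
  set Q : Measure (Fin n → X × ℝ) := Measure.pi fun _ => ρ with hQ
  set P : Measure (Fin n → (X × ℝ) × (X × ℝ)) := Measure.pi fun _ => ρ.prod ρ with hP
  -- `A` is the ghost part of the deviation and `E` the empirical excess. The term with factor 8 in
  -- `A`, there only to make the fluctuation odd, has mean zero given the sample; what remains of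
  -- `A` is the risk.
  let A : (Fin n → X × ℝ) × (X × ℝ) → ℝ := fun q =>
    (G q.1 q.2.1 - f q.2.1) ^ 2 - 8 * ((G q.1 q.2.1 - f q.2.1) * (q.2.2 - f q.2.1))
  let E : (Fin n → X × ℝ) → Fin n → ℝ := fun z i =>
    (G z (z i).1 - (z i).2) ^ 2 - (f (z i).1 - (z i).2) ^ 2
  have hGm : ∀ {α : Type u} [MeasurableSpace α] {s : α → (Fin n → X × ℝ)} {x : α → X},
      Measurable s → Measurable x → Measurable fun a => G (s a) (x a) :=
    fun hs hx => hG.comp (hs.prodMk hx)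
  have hAm : Measurable A := by
    have h1 := hGm (α := (Fin n → X × ℝ) × (X × ℝ)) measurable_fst
      (measurable_fst.comp measurable_snd)
    have h2 : Measurable fun q : (Fin n → X × ℝ) × (X × ℝ) => f q.2.1 :=
      hfm.comp (measurable_fst.comp measurable_snd)
    have h3 : Measurable fun q : (Fin n → X × ℝ) × (X × ℝ) => q.2.2 :=
      measurable_snd.comp measurable_snd
    exact ((h1.sub h2).pow_const 2).sub (((h1.sub h2).mul (h3.sub h2)).const_mul 8)
  have hAi : Integrable A (Q.prod ρ) := by
    refine Integrable.of_bound hAm.aestronglyMeasurable (36 * L ^ 2) ?_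
    filter_upwards [Measure.quasiMeasurePreserving_snd.ae hy,
      Measure.quasiMeasurePreserving_snd.ae hf] with q h1 h2
    have h3 := abs_le.1 (abs_sq_le_of_abs_le (hGL q.1 q.2.1) h2)
    have h4 := abs_le.1 (abs_mul_sub_le (hGL q.1 q.2.1) h2 h1)
    rw [Real.norm_eq_abs, abs_le]
    constructor <;> linarith [h3.1, h3.2, h4.1, h4.2]
  have hEm : ∀ i, Measurable fun z => E z i := by
    intro i
    have h0 : Measurable fun z : Fin n → X × ℝ => z i := measurable_pi_apply i
    have h1 := hGm (α := Fin n → X × ℝ) measurable_id (measurable_fst.comp h0)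
    have h2 : Measurable fun z : Fin n → X × ℝ => f (z i).1 := hfm.comp (measurable_fst.comp h0)
    have h3 : Measurable fun z : Fin n → X × ℝ => (z i).2 := measurable_snd.comp h0
    exact ((h1.sub h3).pow_const 2).sub ((h2.sub h3).pow_const 2)
  have hEi : ∀ i, Integrable (fun z => E z i) Q := by
    intro i
    refine Integrable.of_bound (hEm i).aestronglyMeasurable (8 * L ^ 2) ?_
    filter_upwards [ae_pi_of_ae (n := n) hy, ae_pi_of_ae (n := n) hf] with z h1 h2
    have h3 := abs_le.1 (abs_sq_le_of_abs_le (hGL z (z i).1) (h1 i))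
    have h4 := abs_le.1 (abs_sq_le_of_abs_le (h2 i) (h1 i))
    rw [Real.norm_eq_abs, abs_le]
    constructor <;> linarith [h3.1, h3.2, h4.1, h4.2]
  have hsplit : ∀ (ω : Fin n → (X × ℝ) × (X × ℝ)) (i : Fin n),
      estDeviation f G (fun i => (ω i).1) (ω i).1 (ω i).2 =
        A ((fun j => (ω j).1), (ω i).2) - 4 * E (fun j => (ω j).1) i := by
    intro ω i
    simp only [estDeviation, pairDeviation, A, E]
    ring
  have hmpA := fun i => measurePreserving_sample_ghost (ρ := ρ) (n := n) i
  have hmpE := measurePreserving_sample (ρ := ρ) (n := n)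
  have hAint : ∀ i, Integrable (fun ω : Fin n → (X × ℝ) × (X × ℝ) =>
      A ((fun j => (ω j).1), (ω i).2)) P := fun i =>
    ((hmpA i).integrable_comp hAi.aestronglyMeasurable).2 hAi
  have hEint : ∀ i, Integrable (fun ω : Fin n → (X × ℝ) × (X × ℝ) =>
      E (fun j => (ω j).1) i) P := fun i =>
    (hmpE.integrable_comp (hEi i).aestronglyMeasurable).2 (hEi i)
  have hAval : ∀ i, ∫ ω : Fin n → (X × ℝ) × (X × ℝ), A ((fun j => (ω j).1), (ω i).2) ∂P =
      ∫ z, ∫ p, (G z p.1 - f p.1) ^ 2 ∂ρ ∂Q := by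
    intro i
    have h1 : AEStronglyMeasurable A (Measure.map
        (fun ω : Fin n → (X × ℝ) × (X × ℝ) => ((fun j => (ω j).1), (ω i).2)) P) :=
      hAm.aestronglyMeasurable
    rw [← integral_map (hmpA i).measurable.aemeasurable h1, hP, (hmpA i).map_eq,
      integral_prod _ hAi]
    refine integral_congr_ae (Filter.Eventually.of_forall fun z => ?_)
    have h2 : Measurable fun p : X × ℝ => G z p.1 - f p.1 :=
      (hGm (α := X × ℝ) measurable_const measurable_fst).sub (hfm.comp measurable_fst)
    have h3 : Integrable (fun p : X × ℝ => G z p.1 - f p.1) ρ := by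
      refine Integrable.of_bound h2.aestronglyMeasurable (L + L) ?_
      filter_upwards [hf] with p hp
      exact (abs_sub _ _).trans (add_le_add (hGL _ _) hp)
    have h4 : Integrable (fun p : X × ℝ => (G z p.1 - f p.1) ^ 2) ρ := by
      refine Integrable.of_bound (h2.pow_const 2).aestronglyMeasurable (4 * L ^ 2) ?_
      filter_upwards [hf] with p hp
      exact abs_sq_le_of_abs_le (hGL _ _) hp
    have h5 : Integrable (fun p : X × ℝ => (G z p.1 - f p.1) * (p.2 - f p.1)) ρ := by
      refine Integrable.of_bound (h2.mul (measurable_snd.sub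
        (hfm.comp measurable_fst))).aestronglyMeasurable (4 * L ^ 2) ?_
      filter_upwards [hf, hy] with p hp hp'
      exact abs_mul_sub_le (hGL _ _) hp hp'
    have h6 : ∫ p, (G z p.1 - f p.1) * (p.2 - f p.1) ∂ρ = 0 :=
      integral_mul_sub_regression hy (g := fun x => G z x - f x) h3
    change ∫ p, (G z p.1 - f p.1) ^ 2 - 8 * ((G z p.1 - f p.1) * (p.2 - f p.1)) ∂ρ = _
    rw [integral_sub h4 (h5.const_mul 8), integral_const_mul, h6, mul_zero, sub_zero]
  have hEval : ∀ i, ∫ ω : Fin n → (X × ℝ) × (X × ℝ), E (fun j => (ω j).1) i ∂P =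
      ∫ z, E z i ∂Q := by
    intro i
    have h1 : AEStronglyMeasurable (fun z => E z i) (Measure.map
        (fun (ω : Fin n → (X × ℝ) × (X × ℝ)) j => (ω j).1) P) := (hEm i).aestronglyMeasurable
    rw [← integral_map hmpE.measurable.aemeasurable h1, hP, hmpE.map_eq]
  have hdev := integral_sum_estDeviation_le hL hy hf hGL hgood hcover (by
    refine integrable_finsetSum _ fun i _ => ?_
    simp_rw [hsplit]
    exact (hAint i).sub ((hEint i).const_mul 4))
  simp_rw [hsplit] at hdev
  have hsum : ∫ ω : Fin n → (X × ℝ) × (X × ℝ),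
      ∑ i, (A ((fun j => (ω j).1), (ω i).2) - 4 * E (fun j => (ω j).1) i) ∂P =
      ∑ i, ∫ ω : Fin n → (X × ℝ) × (X × ℝ),
        (A ((fun j => (ω j).1), (ω i).2) - 4 * E (fun j => (ω j).1) i) ∂P :=
    integral_finsetSum _ fun i _ => (hAint i).sub ((hEint i).const_mul 4)
  have hterm : ∀ i : Fin n, ∫ ω : Fin n → (X × ℝ) × (X × ℝ),
      (A ((fun j => (ω j).1), (ω i).2) - 4 * E (fun j => (ω j).1) i) ∂P =
      ∫ z, ∫ p, (G z p.1 - f p.1) ^ 2 ∂ρ ∂Q - 4 * ∫ z, E z i ∂Q := by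
    intro i
    rw [integral_sub (hAint i) ((hEint i).const_mul 4), integral_const_mul, hAval, hEval]
  have hWle := integral_mono_ae (integrable_finsetSum Finset.univ fun i _ => hEi i) hW hGW
  rw [hsum, Finset.sum_congr rfl fun i _ => hterm i, Finset.sum_sub_distrib, Finset.sum_const,
    Finset.card_univ, Fintype.card_fin, nsmul_eq_mul, ← Finset.mul_sum,
    ← integral_finsetSum _ fun i _ => hEi i] at hdev
  linarith

end Deviation

/-! ### The algorithm on a sample as a greedy run in Euclidean space -/

section Empirical

open OSGA
open scoped RealInnerProductSpace

variable {X : Type u} {n N : ℕ}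

/-- Vectors of values at the samples, as elements of a Euclidean space whose inner product is the
empirical one. -/
noncomputable def toEuclid (n : ℕ) : (Fin n → ℝ) →ₗ[ℝ] EuclideanSpace ℝ (Fin n) :=
  (√(n : ℝ))⁻¹ • (WithLp.linearEquiv 2 ℝ (Fin n → ℝ)).symm.toLinearMap

theorem inner_toEuclid (u v : Fin n → ℝ) : ⟪toEuclid n u, toEuclid n v⟫ = empInner u v := by
  have h : (√(n : ℝ))⁻¹ * ((√(n : ℝ))⁻¹) = (n : ℝ)⁻¹ := by
    rw [← mul_inv, Real.mul_self_sqrt (Nat.cast_nonneg n)]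
  simp only [toEuclid, LinearMap.smul_apply, LinearEquiv.coe_coe, WithLp.coe_symm_linearEquiv]
  rw [real_inner_smul_left, real_inner_smul_right, ← mul_assoc, h, PiLp.inner_apply, empInner,
    div_eq_inv_mul]
  congr 1
  exact Finset.sum_congr rfl fun i _ => by simp [mul_comm]

theorem norm_sq_toEuclid (u : Fin n → ℝ) : ‖toEuclid n u‖ ^ 2 = empInner u u := by
  rw [← real_inner_self_eq_norm_sq, inner_toEuclid]

theorem empNorm_nonneg (u : Fin n → ℝ) : 0 ≤ empNorm u := Real.sqrt_nonneg _

theorem empInner_self_nonneg (u : Fin n → ℝ) : 0 ≤ empInner u u := by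
  rw [← norm_sq_toEuclid]; positivity

theorem sq_empNorm (u : Fin n → ℝ) : empNorm u ^ 2 = empInner u u :=
  Real.sq_sqrt (empInner_self_nonneg u)

theorem toEuclid_eq_zero {u : Fin n → ℝ} (h : empNorm u = 0) : toEuclid n u = 0 := by
  rw [← norm_eq_zero, ← sq_eq_zero_iff, norm_sq_toEuclid, ← sq_empNorm, h]
  norm_num

/-- The values of a function at the samples, in the Euclidean space of the empirical norm. -/
noncomputable def sampleEuclid (z : Fin n → X × ℝ) :
    (X → ℝ) →ₗ[ℝ] EuclideanSpace ℝ (Fin n) :=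
  (toEuclid n).comp (LinearMap.funLeft ℝ ℝ fun i => (z i).1)

theorem sampleEuclid_apply (z : Fin n → X × ℝ) (f : X → ℝ) :
    sampleEuclid z f = toEuclid n (onSample z f) := rfl

theorem sampleEuclid_atom (φ : Fin N → X → ℝ) (z : Fin n → X × ℝ) (i : Fin N) :
    sampleEuclid z (atom φ z i) =
      (empNorm (onSample z (φ i)))⁻¹ • toEuclid n (onSample z (φ i)) := by
  rw [atom, map_smul, sampleEuclid_apply]

theorem norm_sampleEuclid_atom (φ : Fin N → X → ℝ) (z : Fin n → X × ℝ) {i : Fin N}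
    (hi : i ∈ active φ z) : ‖sampleEuclid z (atom φ z i)‖ = 1 := by
  have h0 : empNorm (onSample z (φ i)) ≠ 0 := by
    simpa [active] using hi
  have h1 : ‖toEuclid n (onSample z (φ i))‖ = empNorm (onSample z (φ i)) := by
    rw [empNorm, ← norm_sq_toEuclid, Real.sqrt_sq (norm_nonneg _)]
  rw [sampleEuclid_atom, norm_smul, h1, norm_inv, Real.norm_eq_abs,
    abs_of_nonneg (empNorm_nonneg _), inv_mul_cancel₀ h0]

theorem coherence_le_one (φ : Fin N → X → ℝ) (z : Fin n → X × ℝ) : coherence φ z ≤ 1 := by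
  refine iSup₂_le fun i hi => iSup₂_le fun j hj => iSup_le fun _ => ?_
  rw [ENNReal.ofReal_le_one, ← inner_toEuclid]
  have h := abs_real_inner_le_norm (sampleEuclid z (atom φ z i)) (sampleEuclid z (atom φ z j))
  rwa [norm_sampleEuclid_atom φ z hi, norm_sampleEuclid_atom φ z hj, one_mul] at h

theorem isCoherent_sampleEuclid (φ : Fin N → X → ℝ) (z : Fin n → X × ℝ) :
    IsCoherent (fun i => sampleEuclid z (atom φ z i)) (active φ z) (coherence φ z).toReal where
  nonneg := ENNReal.toReal_nonneg
  norm_eq i hi := norm_sampleEuclid_atom φ z hi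
  inner_le i hi j hj hij := by
    have hfin : coherence φ z ≠ ∞ := ((coherence_le_one φ z).trans_lt ENNReal.one_lt_top).ne
    rw [← ENNReal.ofReal_le_iff_le_toReal hfin, sampleEuclid_apply, sampleEuclid_apply,
      inner_toEuclid]
    exact le_iSup₂_of_le i hi (le_iSup₂_of_le j hj (le_iSup_of_le hij le_rfl))

/-- For `c = 0` the inverse is `∞` and `s` is unrestricted. The bound `c * s ≤ 1` follows from `s ≤
2 * (s - 1)` for `s ≥ 2` and from `c ≤ 1` for `s = 1`. -/
theorem stepSize_of_le {c : ℝ≥0∞} (hc : c ≤ 1) {s : ℕ} (hs : 1 ≤ s)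
    (h : (s : ℝ≥0∞) ≤ (2 * c)⁻¹ + 1) : StepSize c.toReal s := by
  have hfin : c ≠ ∞ := (hc.trans_lt ENNReal.one_lt_top).ne
  have hc0 : 0 ≤ c.toReal := ENNReal.toReal_nonneg
  have hc1 : c.toReal ≤ 1 := ENNReal.toReal_le_of_le_ofReal zero_le_one (by simpa using hc)
  have hs1 : (1 : ℝ) ≤ s := by exact_mod_cast hs
  have key : c.toReal * ((s : ℝ) - 1) ≤ 1 / 2 := by
    rcases eq_or_ne c 0 with rfl | hne
    · norm_num
    have hinv : (2 * c)⁻¹ ≠ ∞ := ENNReal.inv_ne_top.2 (mul_ne_zero two_ne_zero hne)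
    have h1 := ENNReal.toReal_mono (ENNReal.add_ne_top.2 ⟨hinv, ENNReal.one_ne_top⟩) h
    rw [ENNReal.toReal_add hinv ENNReal.one_ne_top, ENNReal.toReal_inv, ENNReal.toReal_mul] at h1
    simp only [ENNReal.toReal_natCast, ENNReal.toReal_ofNat, ENNReal.toReal_one] at h1
    have hpos : 0 < c.toReal := ENNReal.toReal_pos hne hfin
    calc c.toReal * ((s : ℝ) - 1) ≤ c.toReal * (2 * c.toReal)⁻¹ :=
          mul_le_mul_of_nonneg_left (by linarith) hc0
      _ = 1 / 2 := by field_simp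
  refine ⟨hs, key, ?_⟩
  rcases hs.eq_or_lt with h1 | h1
  · rw [← h1]; simpa using hc1
  · have h2 : (2 : ℝ) ≤ s := by exact_mod_cast h1
    nlinarith

theorem isGreedyRun_of_isRun {φ : Fin N → X → ℝ} {z : Fin n → X × ℝ} {s m : ℕ}
    {sel : ℕ → Finset (Fin N)} {f : ℕ → X → ℝ} (h : IsRun φ z s m sel f) :
    IsGreedyRun (fun i => sampleEuclid z (atom φ z i)) (active φ z) (toEuclid n (outputs z)) s m
      sel (fun k => sampleEuclid z (f k)) where
  init := by rw [h.init, map_zero]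
  sel_subset := h.sel_subset
  sel_card := h.sel_card
  sel_top k hk i hi j hj hjk := by
    simpa only [sampleEuclid_apply, ← map_sub, inner_toEuclid] using h.sel_top k hk i hi j hj hjk
  proj_mem k hk := by
    have h1 := Submodule.mem_map_of_mem (f := sampleEuclid z) (h.proj_mem k hk)
    rw [selectedSpan, Submodule.map_span] at h1
    refine Submodule.span_mono ?_ h1
    rintro _ ⟨g, ⟨l, hl, i, hi, rfl⟩, rfl⟩
    exact ⟨l, hl, i, hi, rfl⟩
  proj_orthogonal k hk l hl i hi := by
    simpa only [sampleEuclid_apply, ← map_sub, inner_toEuclid] using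
      h.proj_orthogonal k hk _ (Submodule.subset_span ⟨l, hl, i, hi, rfl⟩)

/-- Inactive functions vanish on the sample, so dropping them costs nothing. -/
theorem sampleEuclid_sum (φ : Fin N → X → ℝ) (z : Fin n → X × ℝ) (a : Fin N → ℝ) :
    sampleEuclid z (∑ i, a i • φ i) =
      ∑ i ∈ active φ z, (a i * empNorm (onSample z (φ i))) • sampleEuclid z (atom φ z i) := by
  rw [map_sum]
  refine (Finset.sum_subset (Finset.subset_univ (active φ z)) fun i _ hi => ?_).symm.trans
    (Finset.sum_congr rfl fun i hi => ?_)
  · have h0 : empNorm (onSample z (φ i)) = 0 := by simpa [active] using hi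
    rw [map_smul, sampleEuclid_apply, toEuclid_eq_zero h0, smul_zero]
  · have h0 : empNorm (onSample z (φ i)) ≠ 0 := by simpa [active] using hi
    rw [map_smul, sampleEuclid_apply, sampleEuclid_atom, smul_smul, mul_assoc,
      mul_inv_cancel₀ h0, mul_one]

/-- The empirical error of the orthogonal super greedy algorithm, compared with that of an
arbitrary element of the span of the dictionary. -/
theorem empInner_estimator_le {φ : Fin N → X → ℝ} {z : Fin n → X × ℝ} {s m : ℕ} {F : X → ℝ}
    (hF : IsEstimator φ z s m F) (hs : 1 ≤ s) (hm : 0 < m)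
    (hcoh : (s : ℝ≥0∞) ≤ (2 * coherence φ z)⁻¹ + 1) (a : Fin N → ℝ) :
    empInner (outputs z - onSample z F) (outputs z - onSample z F) ≤
      empInner (outputs z - onSample z (∑ i, a i • φ i))
        (outputs z - onSample z (∑ i, a i • φ i)) +
      300 * ((∑ i, |a i|) * ∑ i, |a i| * empInner (onSample z (φ i)) (onSample z (φ i))) /
        (s * m) := by
  obtain ⟨sel, f, hrun, rfl⟩ := hF
  have h := (isGreedyRun_of_isRun hrun).norm_sq_le (isCoherent_sampleEuclid φ z)
    (stepSize_of_le (coherence_le_one φ z) hs hcoh) hm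
    (fun i => a i * empNorm (onSample z (φ i)))
  rw [← sampleEuclid_sum] at h
  simp only [sampleEuclid_apply, ← map_sub, norm_sq_toEuclid] at h
  refine h.trans ?_
  gcongr
  -- Splitting `|a i|` into two square roots lets Cauchy–Schwarz produce a bound linear in the
  -- squared empirical norms, whose expectations are at most 1.
  have hsub : ∑ i ∈ active φ z, |a i * empNorm (onSample z (φ i))| ≤
      ∑ i, √|a i| * (√|a i| * empNorm (onSample z (φ i))) := by
    refine (Finset.sum_le_sum_of_subset_of_nonneg (Finset.subset_univ _)
      fun _ _ _ => abs_nonneg _).trans (Finset.sum_le_sum fun i _ => ?_)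
    rw [← mul_assoc, Real.mul_self_sqrt (abs_nonneg _), abs_mul,
      abs_of_nonneg (empNorm_nonneg _)]
  refine (pow_le_pow_left₀ (Finset.sum_nonneg fun _ _ => abs_nonneg _) hsub 2).trans ?_
  refine (Finset.sum_mul_sq_le_sq_mul_sq _ _ _).trans_eq ?_
  congr 1
  · exact Finset.sum_congr rfl fun i _ => Real.sq_sqrt (abs_nonneg _)
  · exact Finset.sum_congr rfl fun i _ => by
      rw [mul_pow, Real.sq_sqrt (abs_nonneg _), sq_empNorm]

theorem exists_mem_span_of_isEstimator {φ : Fin N → X → ℝ} {z : Fin n → X × ℝ} {s m : ℕ}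
    {F : X → ℝ} (hF : IsEstimator φ z s m F) (hm : 0 < m) :
    ∃ Λ : Finset (Fin N), Λ.card ≤ s * m ∧ F ∈ Submodule.span ℝ (φ '' Λ) := by
  classical
  obtain ⟨sel, f, hrun, rfl⟩ := hF
  obtain ⟨k, rfl⟩ := Nat.exists_eq_add_of_lt hm
  rw [zero_add] at *
  refine ⟨(Finset.range (k + 1)).biUnion sel, ?_, ?_⟩
  · rw [mul_comm]
    refine (Finset.card_biUnion_le_card_mul _ _ s fun l hl => ?_).trans
      (by rw [Finset.card_range])
    exact (hrun.sel_card l (Finset.mem_range.1 hl)).trans_le (min_le_left _ _)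
  · have h := hrun.proj_mem k (by omega)
    refine Submodule.span_le.2 ?_ h
    rintro _ ⟨l, hl, i, hi, rfl⟩
    refine Submodule.smul_mem _ _ (Submodule.subset_span ⟨i, ?_, rfl⟩)
    simp only [Finset.coe_biUnion, Finset.coe_range, Set.mem_iUnion, Set.mem_Iio]
    exact ⟨l, hl, hi⟩

end Empirical

/-! ### The risk bound for a given number of selected atoms -/

section Risk

open OSGA

/-- The slack 1 avoids the question whether the infimum is attained. -/
theorem exists_coeff_of_l1Norm_le {X : Type u} {N : ℕ} {φ : Fin N → X → ℝ} {h : X → ℝ} {B : ℝ}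
    (hh : h ∈ Submodule.span ℝ (Set.range φ)) (hB : l1Norm φ h ≤ B) :
    0 ≤ B ∧ ∃ a : Fin N → ℝ, h = ∑ i, a i • φ i ∧ ∑ i, |a i| ≤ B + 1 := by
  constructor
  · refine (Real.sInf_nonneg ?_).trans hB
    rintro t ⟨a, _, rfl⟩
    exact Finset.sum_nonneg fun _ _ => abs_nonneg _
  · obtain ⟨b, hb⟩ := (Submodule.mem_span_range_iff_exists_fun ℝ).1 hh
    obtain ⟨t, ⟨a, ha, rfl⟩, hlt⟩ := exists_lt_of_csInf_lt
      (s := {t | ∃ a : Fin N → ℝ, h = ∑ i, a i • φ i ∧ t = ∑ i, |a i|})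
      ⟨_, b, hb.symm, rfl⟩ (show l1Norm φ h < B + 1 by linarith)
    exact ⟨a, ha, hlt.le⟩

variable {X : Type u} [MeasurableSpace X] {ρ : Measure (X × ℝ)}

theorem eLpNorm_two_sq_fst {g : X → ℝ} (hg : Measurable g) :
    eLpNorm g 2 ρ.fst ^ 2 = ∫⁻ p, ENNReal.ofReal (g p.1 ^ 2) ∂ρ := by
  have h := eLpNorm_nnreal_pow_eq_lintegral (f := g) (μ := ρ.fst) (p := 2) two_ne_zero
  have h2 : ∀ x, ‖g x‖ₑ ^ (2 : ℝ) = ENNReal.ofReal (g x ^ 2) := by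
    intro x
    rw [ENNReal.rpow_two, Real.enorm_eq_ofReal_abs, ← ENNReal.ofReal_pow (abs_nonneg _), sq_abs]
  simp only [ENNReal.coe_ofNat, NNReal.coe_ofNat, ENNReal.rpow_two] at h
  rw [h, Measure.fst, lintegral_map (by fun_prop) measurable_fst]
  refine lintegral_congr fun p => ?_
  rw [← h2, ENNReal.rpow_two]

theorem integrable_sq_of_eLpNorm_le {g : X → ℝ} (hg : Measurable g) {c : ℝ} (hc : 0 ≤ c)
    (h : eLpNorm g 2 ρ.fst ≤ ENNReal.ofReal c) :
    Integrable (fun p : X × ℝ => g p.1 ^ 2) ρ ∧ ∫ p, g p.1 ^ 2 ∂ρ ≤ c ^ 2 := by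
  have hm : Measurable fun p : X × ℝ => g p.1 ^ 2 := (hg.comp measurable_fst).pow_const 2
  have h1 : ∫⁻ p, ENNReal.ofReal (g p.1 ^ 2) ∂ρ ≤ ENNReal.ofReal (c ^ 2) := by
    rw [← eLpNorm_two_sq_fst hg, ENNReal.ofReal_pow hc]
    gcongr
  have hnn : 0 ≤ᵐ[ρ] fun p => g p.1 ^ 2 := Filter.Eventually.of_forall fun _ => sq_nonneg _
  have hi : Integrable (fun p : X × ℝ => g p.1 ^ 2) ρ :=
    ⟨hm.aestronglyMeasurable,
      (hasFiniteIntegral_iff_ofReal hnn).2 (h1.trans_lt ENNReal.ofReal_lt_top)⟩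
  refine ⟨hi, ?_⟩
  rw [← ofReal_integral_eq_lintegral_ofReal hi hnn] at h1
  exact (ENNReal.ofReal_le_ofReal_iff (sq_nonneg c)).1 h1

variable [IsProbabilityMeasure ρ] {L : ℝ} {n : ℕ}

theorem lintegral_eLpNorm_sq_eq (hy : ∀ᵐ p ∂ρ, |p.2| ≤ L)
    {G : (Fin n → X × ℝ) → X → ℝ} (hG : Measurable (Function.uncurry G))
    (hGL : ∀ z x, |G z x| ≤ L) :
    ∫⁻ z, eLpNorm (fun x => G z x - regression ρ x) 2 ρ.fst ^ 2
      ∂(Measure.pi fun _ : Fin n => ρ) =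
    ENNReal.ofReal (∫ z, ∫ p, (G z p.1 - regression ρ p.1) ^ 2 ∂ρ
      ∂(Measure.pi fun _ : Fin n => ρ)) := by
  have hf := abs_regression_le hy
  have hfm := measurable_regression (ρ := ρ)
  set f := regression ρ
  have hm : Measurable fun q : (Fin n → X × ℝ) × (X × ℝ) => (G q.1 q.2.1 - f q.2.1) ^ 2 := by
    have h1 : Measurable fun q : (Fin n → X × ℝ) × (X × ℝ) => G q.1 q.2.1 :=
      hG.comp (measurable_fst.prodMk (measurable_fst.comp measurable_snd))
    exact (h1.sub (hfm.comp (measurable_fst.comp measurable_snd))).pow_const 2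
  have hzm : ∀ z, Measurable fun x => G z x - f x := fun z =>
    (hG.comp (measurable_const.prodMk measurable_id)).sub hfm
  have hi : ∀ z, Integrable (fun p : X × ℝ => (G z p.1 - f p.1) ^ 2) ρ := by
    intro z
    refine Integrable.of_bound
      (((hzm z).comp measurable_fst).pow_const 2).aestronglyMeasurable (4 * L ^ 2) ?_
    filter_upwards [hf] with p hp
    exact abs_sq_le_of_abs_le (hGL _ _) hp
  have hRm : StronglyMeasurable fun z => ∫ p, (G z p.1 - f p.1) ^ 2 ∂ρ :=
    StronglyMeasurable.integral_prod_right (f := fun z p => (G z (Prod.fst p) - f p.1) ^ 2)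
      hm.stronglyMeasurable
  have hR0 : ∀ z, 0 ≤ ∫ p, (G z p.1 - f p.1) ^ 2 ∂ρ := fun z =>
    integral_nonneg fun _ => sq_nonneg _
  have hRi : Integrable (fun z => ∫ p, (G z p.1 - f p.1) ^ 2 ∂ρ)
      (Measure.pi fun _ : Fin n => ρ) := by
    refine Integrable.of_bound hRm.aestronglyMeasurable (4 * L ^ 2)
      (Filter.Eventually.of_forall fun z => ?_)
    have := norm_integral_le_of_norm_le_const (μ := ρ)
      (f := fun p : X × ℝ => (G z p.1 - f p.1) ^ 2) (C := 4 * L ^ 2) (by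
        filter_upwards [hf] with p hp
        exact abs_sq_le_of_abs_le (hGL _ _) hp)
    simpa using this
  rw [ofReal_integral_eq_lintegral_ofReal hRi (Filter.Eventually.of_forall hR0)]
  refine lintegral_congr fun z => ?_
  rw [eLpNorm_two_sq_fst (hzm z), ofReal_integral_eq_lintegral_ofReal (hi z)
    (Filter.Eventually.of_forall fun _ => sq_nonneg _)]

theorem integral_excess_eq (hy : ∀ᵐ p ∂ρ, |p.2| ≤ L) {h : X → ℝ} (hh : Measurable h)
    (hi : Integrable (fun p : X × ℝ => (h p.1 - regression ρ p.1) ^ 2) ρ) :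
    Integrable (fun p : X × ℝ => (h p.1 - p.2) ^ 2 - (regression ρ p.1 - p.2) ^ 2) ρ ∧
      ∫ p, ((h p.1 - p.2) ^ 2 - (regression ρ p.1 - p.2) ^ 2) ∂ρ =
        ∫ p, (h p.1 - regression ρ p.1) ^ 2 ∂ρ := by
  have hf := abs_regression_le hy
  have hfm := measurable_regression (ρ := ρ)
  set f := regression ρ with hfdef
  have hm : Measurable fun p : X × ℝ => h p.1 - f p.1 :=
    (hh.comp measurable_fst).sub (hfm.comp measurable_fst)
  have h1 : Integrable (fun p : X × ℝ => h p.1 - f p.1) ρ :=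
    ((memLp_two_iff_integrable_sq hm.aestronglyMeasurable).2 hi).integrable one_le_two
  have h2 : Integrable (fun p : X × ℝ => (h p.1 - f p.1) * (p.2 - f p.1)) ρ := by
    refine h1.mul_bdd (c := L + L) (by fun_prop) ?_
    filter_upwards [hy, hf] with p h1 h2
    exact (abs_sub _ _).trans (add_le_add h1 h2)
  have h3 : ∫ p, (h p.1 - f p.1) * (p.2 - f p.1) ∂ρ = 0 :=
    integral_mul_sub_regression hy (g := fun x => h x - f x) h1
  have e : (fun p : X × ℝ => (h p.1 - p.2) ^ 2 - (f p.1 - p.2) ^ 2) =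
      fun p => (h p.1 - f p.1) ^ 2 - 2 * ((h p.1 - f p.1) * (p.2 - f p.1)) := by
    ext p; ring
  rw [e]
  refine ⟨hi.sub (h2.const_mul 2), ?_⟩
  rw [integral_sub hi (h2.const_mul 2), integral_const_mul, h3, mul_zero, sub_zero]

theorem integral_sum_eval {w : X × ℝ → ℝ} (hw : Integrable w ρ) :
    Integrable (fun z : Fin n → X × ℝ => ∑ i, w (z i)) (Measure.pi fun _ => ρ) ∧
      ∫ z : Fin n → X × ℝ, ∑ i, w (z i) ∂(Measure.pi fun _ => ρ) = n * ∫ p, w p ∂ρ := by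
  have h1 : ∀ i : Fin n, Integrable (fun z : Fin n → X × ℝ => w (z i)) (Measure.pi fun _ => ρ) :=
    fun i => integrable_comp_eval (μ := fun _ : Fin n => ρ) hw
  refine ⟨integrable_finsetSum _ fun i _ => h1 i, ?_⟩
  rw [integral_finsetSum _ fun i _ => h1 i]
  have h2 : ∀ i : Fin n, ∫ z : Fin n → X × ℝ, w (z i) ∂(Measure.pi fun _ => ρ) = ∫ p, w p ∂ρ :=
    fun i => integral_comp_eval (μ := fun _ : Fin n => ρ) hw.aestronglyMeasurable
  rw [Finset.sum_congr rfl fun i _ => h2 i]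
  simp

/-- The risk of the orthogonal super greedy algorithm with about `q` selected atoms. -/
theorem risk_le {r B c₃ c₄ q : ℝ} {N : ℕ} (hL : 0 < L) (hy : ∀ᵐ p ∂ρ, |p.2| ≤ L)
    {φ : (N : ℕ) → Fin N → X → ℝ} (hφ : ∀ N i, Measurable (φ N i))
    (hφ1 : ∀ N i, eLpNorm (φ N i) 2 ρ.fst = 1) (hB : MemL1r φ ρ.fst r (regression ρ) B)
    (hn : 0 < n) (hN : 0 < N) (hq : 0 < q) (hc₃ : 0 < c₃)
    {s m : (Fin n → X × ℝ) → ℕ} {F : (Fin n → X × ℝ) → X → ℝ}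
    (hF : Measurable (Function.uncurry F))
    (hest : ∀ᵐ z ∂(Measure.pi fun _ : Fin n => ρ),
      1 ≤ s z ∧ (s z : ℝ≥0∞) ≤ (2 * coherence (φ N) z)⁻¹ + 1 ∧
        IsEstimator (φ N) z (s z) (m z) (F z))
    (hm : ∀ᵐ z ∂(Measure.pi fun _ : Fin n => ρ),
      c₃ * (q / s z) ≤ m z ∧ (m z : ℝ) ≤ c₄ * (q / s z)) :
    risk ρ L F ≤ ENNReal.ofReal (4 * (B * (N : ℝ) ^ (-r)) ^ 2 +
      1200 * (B + 1) ^ 2 / (c₃ * q) + (400 * L ^ 2 * Real.log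
        (N ^ ⌊c₄ * q⌋₊ * (2 * n * n + 1) ^ (⌊c₄ * q⌋₊ + 1) : ℕ) + 104 * L ^ 2) / n) := by
  obtain ⟨h, hspan, hl1, hdist⟩ := hB N hN
  obtain ⟨hB0, a, ha, haB⟩ := exists_coeff_of_l1Norm_le hspan hl1
  have hn0 : (0 : ℝ) < n := by exact_mod_cast hn
  have hfm := measurable_regression (ρ := ρ)
  have hhm : Measurable h := by
    rw [ha, Finset.sum_fn]; exact Finset.measurable_sum _ fun i _ => (hφ N i).const_smul (a i)
  set D := ⌊c₄ * q⌋₊ with hD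
  have ha0 : 0 ≤ ∑ j, |a j| := Finset.sum_nonneg fun _ _ => abs_nonneg _
  set κ := 300 * (B + 1) / (c₃ * q) with hκ
  have hκ0 : 0 ≤ κ := by positivity
  -- the integrals of the approximation error and of the squared dictionary functions
  have happ : Integrable (fun p : X × ℝ => (h p.1 - regression ρ p.1) ^ 2) ρ ∧
      ∫ p, (h p.1 - regression ρ p.1) ^ 2 ∂ρ ≤ (B * (N : ℝ) ^ (-r)) ^ 2 := by
    have := integrable_sq_of_eLpNorm_le (ρ := ρ) (hfm.sub hhm) (by positivity) hdist
    simpa only [Pi.sub_apply, sub_sq_comm] using this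
  have hdict : ∀ j, Integrable (fun p : X × ℝ => φ N j p.1 ^ 2) ρ ∧
      ∫ p, φ N j p.1 ^ 2 ∂ρ ≤ 1 := by
    intro j
    simpa using integrable_sq_of_eLpNorm_le (ρ := ρ) (hφ N j) zero_le_one
      (by rw [hφ1, ENNReal.ofReal_one])
  obtain ⟨hexi, hex⟩ := integral_excess_eq hy hhm happ.1
  -- The bound on the empirical excess is a sum of `w` over the sample: the excess of the fixed
  -- competitor `h` plus the optimization error. Its expectation is `n` times a single integral.
  let w : X × ℝ → ℝ := fun p => ((h p.1 - p.2) ^ 2 - (regression ρ p.1 - p.2) ^ 2) +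
    κ * ∑ j, |a j| * φ N j p.1 ^ 2
  have hdi : Integrable (fun p : X × ℝ => ∑ j, |a j| * φ N j p.1 ^ 2) ρ :=
    integrable_finsetSum _ fun j _ => (hdict j).1.const_mul _
  have hwi : Integrable w ρ := hexi.add (hdi.const_mul κ)
  have hwint : ∫ p, w p ∂ρ ≤ (B * (N : ℝ) ^ (-r)) ^ 2 + κ * (B + 1) := by
    rw [integral_add hexi (hdi.const_mul κ), hex, integral_const_mul,
      integral_finsetSum _ fun j _ => (hdict j).1.const_mul _]
    refine add_le_add happ.2 (mul_le_mul_of_nonneg_left (le_trans ?_ haB) hκ0)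
    refine Finset.sum_le_sum fun j _ => ?_
    rw [integral_const_mul]
    exact mul_le_of_le_one_right (abs_nonneg _) (hdict j).2
  obtain ⟨hWi, hW⟩ := integral_sum_eval (n := n) hwi
  -- properties of almost every sample
  have hpos : ∀ {s m : ℕ}, 1 ≤ s → c₃ * (q / s) ≤ m → 0 < m ∧ c₃ * q ≤ s * m := by
    intro s m hs hm
    have hs0 : (0 : ℝ) < s := by exact_mod_cast hs
    have h1 : 0 < c₃ * (q / s) := by positivity
    refine ⟨by exact_mod_cast h1.trans_le hm, ?_⟩
    have h2 := mul_le_mul_of_nonneg_left hm hs0.le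
    calc c₃ * q = s * (c₃ * (q / s)) := by field_simp
      _ ≤ _ := h2
  have hgood : ∀ᵐ z ∂(Measure.pi fun _ : Fin n => ρ), z ∈ {z | ∃ Λ : Finset (Fin N),
      Λ.card ≤ D ∧ F z ∈ Submodule.span ℝ (φ N '' Λ)} := by
    filter_upwards [hest, hm] with z h1 h2
    obtain ⟨hs1, -, hE⟩ := h1
    obtain ⟨Λ, hΛ, hmem⟩ := exists_mem_span_of_isEstimator hE (hpos hs1 h2.1).1
    refine ⟨Λ, hΛ.trans (Nat.le_floor ?_), hmem⟩
    have hs0 : (0 : ℝ) < s z := by exact_mod_cast hs1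
    push_cast
    calc (s z : ℝ) * m z ≤ s z * (c₄ * (q / s z)) := mul_le_mul_of_nonneg_left h2.2 hs0.le
      _ = c₄ * q := by field_simp
  have hGW : ∀ᵐ z ∂(Measure.pi fun _ : Fin n => ρ), ∑ i, ((trunc L (F z (z i).1) - (z i).2) ^ 2 -
      (regression ρ (z i).1 - (z i).2) ^ 2) ≤ ∑ i, w (z i) := by
    filter_upwards [hest, hm, ae_pi_of_ae (n := n) hy] with z h1 h2 h3
    obtain ⟨hs1, hcoh, hE⟩ := h1
    obtain ⟨hm0, hsm⟩ := hpos hs1 h2.1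
    have hemp := empInner_estimator_le hE hs1 hm0 hcoh a
    rw [← ha] at hemp
    have e1 : ∀ g : X → ℝ, empInner (outputs z - onSample z g) (outputs z - onSample z g) =
        (∑ i, (g (z i).1 - (z i).2) ^ 2) / n := by
      intro g
      rw [empInner]
      congr 1
      exact Finset.sum_congr rfl fun i _ => by simp only [Pi.sub_apply, outputs, onSample]; ring
    have e2 : ∀ j, empInner (onSample z (φ N j)) (onSample z (φ N j)) =
        (∑ i, φ N j (z i).1 ^ 2) / n := by
      intro j
      rw [empInner]
      congr 1
      exact Finset.sum_congr rfl fun i _ => by simp only [onSample]; ring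
    simp only [e1, e2] at hemp
    have e3 : ∑ j, |a j| * ((∑ i, φ N j (z i).1 ^ 2) / n) =
        (∑ i, ∑ j, |a j| * φ N j (z i).1 ^ 2) / n := by
      rw [Finset.sum_comm, Finset.sum_div]
      exact Finset.sum_congr rfl fun j _ => by rw [mul_div_assoc', Finset.mul_sum]
    rw [e3] at hemp
    set Y := ∑ i, ∑ j, |a j| * φ N j (z i).1 ^ 2 with hY
    have hY0 : 0 ≤ Y := Finset.sum_nonneg fun _ _ => Finset.sum_nonneg fun _ _ =>
      mul_nonneg (abs_nonneg _) (sq_nonneg _)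
    have h4 : 300 * ((∑ j, |a j|) * (Y / n)) / (s z * m z) ≤ κ * Y / n := by
      calc 300 * ((∑ j, |a j|) * (Y / n)) / (s z * m z)
          ≤ 300 * ((B + 1) * (Y / n)) / (c₃ * q) := by gcongr
        _ = _ := by rw [hκ]; ring
    have h5 : ∑ i, (F z (z i).1 - (z i).2) ^ 2 ≤ ∑ i, (h (z i).1 - (z i).2) ^ 2 + κ * Y := by
      have h6 := hemp.trans (add_le_add_right h4 _)
      rwa [← add_div, div_le_div_iff_of_pos_right hn0] at h6
    have h7 : ∑ i, (trunc L (F z (z i).1) - (z i).2) ^ 2 ≤ ∑ i, (F z (z i).1 - (z i).2) ^ 2 :=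
      Finset.sum_le_sum fun i _ => sq_le_sq.2 (abs_trunc_sub_le hL (h3 i) _)
    simp only [w, Finset.sum_add_distrib, Finset.sum_sub_distrib, ← Finset.mul_sum]
    linarith
  have hGm : Measurable (Function.uncurry fun z x => trunc L (F z x)) :=
    (measurable_trunc hL).comp hF
  have hGL : ∀ (z : Fin n → X × ℝ) x, |trunc L (F z x)| ≤ L := fun z x => abs_trunc_le hL _
  have hcover : ∀ p : Fin n × Bool → X, ∃ C : Finset (Fin n × Bool → ℝ),
      C.card ≤ N ^ D * (2 * n * n + 1) ^ (D + 1) ∧ (∀ c ∈ C, ∀ i, |c i| ≤ L) ∧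
      ∀ z ∈ {z | ∃ Λ : Finset (Fin N), Λ.card ≤ D ∧ F z ∈ Submodule.span ℝ (φ N '' Λ)},
        ∃ c ∈ C, ∀ i, |trunc L (F z (p i)) - c i| ≤ 2 * L / n := by
    intro p
    -- A grid of `n` levels makes the discretization error `2L / n`, which contributes only a
    -- constant to the sum over the sample.
    obtain ⟨C, h1, h2, h3⟩ := exists_cover hN (φ N) D p hL hn
    refine ⟨C, h1.trans_eq ?_, h2, fun z hz => ?_⟩
    · rw [Fintype.card_prod, Fintype.card_fin, Fintype.card_bool, mul_comm n 2]
    · obtain ⟨Λ, hΛ, hmem⟩ := hz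
      exact h3 Λ hΛ _ hmem
  have hmain := integral_risk_le hL hy hGm hGL hgood hcover hWi hGW
  rw [risk, lintegral_eLpNorm_sq_eq hy hGm hGL]
  refine ENNReal.ofReal_le_ofReal ?_
  rw [hW, ← le_div_iff₀' hn0] at hmain
  refine hmain.trans ?_
  have e1 : (n : ℝ) * (52 * L * (2 * L / n)) = 104 * L ^ 2 := by field_simp; ring
  have e2 : 4 * (κ * (B + 1)) = 1200 * (B + 1) ^ 2 / (c₃ * q) := by rw [hκ]; ring
  rw [e1, add_div, mul_left_comm, mul_div_cancel_left₀ _ hn0.ne', ← e2]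
  linarith

end Risk

/-! ### Balancing the three error terms -/

section Rate

theorem log_cover_le {a c₁ c₂ : ℝ} (hc₁ : 0 < c₁) (ha : 0 < a) {n N : ℕ} (hn : 2 ≤ n)
    (hN₁ : c₁ * (n : ℝ) ^ a ≤ N) (hN₂ : (N : ℝ) ≤ c₂ * (n : ℝ) ^ a) (D : ℕ) :
    Real.log (N ^ D * (2 * n * n + 1) ^ (D + 1) : ℕ) ≤
      (D + 1) * ((2 * |Real.log c₂| + a + 4) * Real.log n) := by
  have hn0 : (0 : ℝ) < n := by positivity
  have hna : 0 < (n : ℝ) ^ a := Real.rpow_pos_of_pos hn0 a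
  have hN0 : (0 : ℝ) < N := (mul_pos hc₁ hna).trans_le hN₁
  have hc₂ : 0 < c₂ := pos_of_mul_pos_left (hN0.trans_le hN₂) hna.le
  have hℓ : 1 / 2 ≤ Real.log n := by
    have h1 := Real.log_le_log two_pos (by exact_mod_cast hn : (2 : ℝ) ≤ n)
    linarith [Real.log_two_gt_d9]
  have h1 : Real.log N ≤ (2 * |Real.log c₂| + a) * Real.log n := by
    have h2 := Real.log_le_log hN0 hN₂
    rw [Real.log_mul hc₂.ne' hna.ne', Real.log_rpow hn0] at h2
    nlinarith [le_abs_self (Real.log c₂), abs_nonneg (Real.log c₂)]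
  have h3 : Real.log (2 * n * n + 1 : ℕ) ≤ 4 * Real.log n := by
    have h4 : (2 * n * n + 1 : ℕ) ≤ n ^ 4 := by
      have : 4 ≤ n * n := Nat.mul_le_mul hn hn
      nlinarith
    have h5 := Real.log_le_log (by positivity)
      (by exact_mod_cast h4 : ((2 * n * n + 1 : ℕ) : ℝ) ≤ (n : ℝ) ^ 4)
    rw [Real.log_pow] at h5
    exact_mod_cast h5
  have hlogN : 0 ≤ (2 * |Real.log c₂| + a) * Real.log n := by positivity
  rw [Nat.cast_mul, Nat.cast_pow, Nat.cast_pow, Real.log_mul (by positivity) (by positivity),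
    Real.log_pow, Real.log_pow]
  have h6 := mul_le_mul_of_nonneg_left h1 (Nat.cast_nonneg (α := ℝ) D)
  have h7 := mul_le_mul_of_nonneg_left h3 (Nat.cast_nonneg (α := ℝ) (D + 1))
  push_cast at h7 ⊢
  linarith

/-- The assumption on `a` says exactly `2 * a * r ≥ 1 / 2`. -/
theorem approx_error_le {a r c₁ B : ℝ} (hr : 0 < r) (ha : 1 / (4 * r) ≤ a) (hc₁ : 0 < c₁)
    {n N : ℕ} (hn : 2 ≤ n) (hN₁ : c₁ * (n : ℝ) ^ a ≤ N) :
    (B * (N : ℝ) ^ (-r)) ^ 2 ≤ (B * c₁ ^ (-r)) ^ 2 * (n : ℝ) ^ (-(1 / 2) : ℝ) := by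
  have hn1 : (1 : ℝ) ≤ n := by exact_mod_cast (by omega : 1 ≤ n)
  have hn0 : (0 : ℝ) < n := by positivity
  have hna : 0 < (n : ℝ) ^ a := Real.rpow_pos_of_pos hn0 a
  have h1 : (N : ℝ) ^ (-r) ≤ c₁ ^ (-r) * (n : ℝ) ^ (-(1 / 4) : ℝ) := by
    calc (N : ℝ) ^ (-r) ≤ (c₁ * (n : ℝ) ^ a) ^ (-r) :=
          Real.rpow_le_rpow_of_nonpos (mul_pos hc₁ hna) hN₁ (by linarith)
      _ = c₁ ^ (-r) * (n : ℝ) ^ (a * -r) := by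
          rw [Real.mul_rpow hc₁.le hna.le, ← Real.rpow_mul hn0.le]
      _ ≤ _ := by
          refine mul_le_mul_of_nonneg_left (Real.rpow_le_rpow_of_exponent_le hn1 ?_)
            (Real.rpow_nonneg hc₁.le _)
          rw [div_le_iff₀ (by positivity)] at ha
          linarith
  have h2 : ((n : ℝ) ^ (-(1 / 4) : ℝ)) ^ 2 = (n : ℝ) ^ (-(1 / 2) : ℝ) := by
    rw [← Real.rpow_natCast, ← Real.rpow_mul hn0.le]
    norm_num
  calc (B * (N : ℝ) ^ (-r)) ^ 2 = B ^ 2 * ((N : ℝ) ^ (-r)) ^ 2 := mul_pow _ _ _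
    _ ≤ B ^ 2 * (c₁ ^ (-r) * (n : ℝ) ^ (-(1 / 4) : ℝ)) ^ 2 :=
      mul_le_mul_of_nonneg_left
        (pow_le_pow_left₀ (Real.rpow_nonneg (Nat.cast_nonneg _) _) h1 2) (sq_nonneg _)
    _ = (B * c₁ ^ (-r)) ^ 2 * (n : ℝ) ^ (-(1 / 2) : ℝ) := by rw [← h2]; ring

/-- The constant in the risk bounds. -/
noncomputable def riskConst (L a r c₁ c₂ c₃ c₄ B : ℝ) : ℝ :=
  8 * (B * c₁ ^ (-r)) ^ 2 + 2400 * (B + 1) ^ 2 / c₃ +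
    (400 * L ^ 2 * ((|c₄| + 1) * (2 * |Real.log c₂| + a + 4)) + 208 * L ^ 2)

/-- The three hypotheses on `δ` treat approximation, optimization and complexity. The factors 2
leave room for the bound `1/2 ≤ log n`, valid for `n ≥ 2`. -/
theorem risk_bound_le {L a r c₁ c₂ c₃ c₄ B q δ : ℝ} (hr : 0 < r)
    (ha : 1 / (4 * r) ≤ a) (hc₁ : 0 < c₁) (hc₃ : 0 < c₃) {n N : ℕ} (hn : 2 ≤ n)
    (hN₁ : c₁ * (n : ℝ) ^ a ≤ N) (hN₂ : (N : ℝ) ≤ c₂ * (n : ℝ) ^ a) (hq : 1 ≤ q)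
    (hδ₁ : (n : ℝ) ^ (-(1 / 2) : ℝ) ≤ 2 * δ) (hδ₂ : 1 / q ≤ 2 * δ)
    (hδ₃ : q * Real.log n / n ≤ δ) :
    4 * (B * (N : ℝ) ^ (-r)) ^ 2 + 1200 * (B + 1) ^ 2 / (c₃ * q) + (400 * L ^ 2 * Real.log
        (N ^ ⌊c₄ * q⌋₊ * (2 * n * n + 1) ^ (⌊c₄ * q⌋₊ + 1) : ℕ) + 104 * L ^ 2) / n ≤
      riskConst L a r c₁ c₂ c₃ c₄ B * δ := by
  have hn0 : (0 : ℝ) < n := by positivity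
  have ha0 : 0 < a := lt_of_lt_of_le (by positivity) ha
  have hℓ : 1 / 2 ≤ Real.log n := by
    have h1 := Real.log_le_log two_pos (by exact_mod_cast hn : (2 : ℝ) ≤ n)
    linarith [Real.log_two_gt_d9]
  have hlog := log_cover_le hc₁ ha0 hn hN₁ hN₂ ⌊c₄ * q⌋₊
  have happ := approx_error_le (B := B) hr ha hc₁ hn hN₁
  set K := Real.log (N ^ ⌊c₄ * q⌋₊ * (2 * n * n + 1) ^ (⌊c₄ * q⌋₊ + 1) : ℕ)
  set Q := 2 * |Real.log c₂| + a + 4 with hQ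
  have hQ0 : 0 < Q := by positivity
  have hD : (⌊c₄ * q⌋₊ : ℝ) + 1 ≤ (|c₄| + 1) * q := by
    have h1 : (⌊c₄ * q⌋₊ : ℝ) ≤ |c₄| * q := by
      refine (Nat.cast_le.2 (Nat.floor_mono (mul_le_mul_of_nonneg_right (le_abs_self c₄)
        (by linarith)))).trans (Nat.floor_le (by positivity))
    linarith
  have hK : K ≤ (|c₄| + 1) * Q * (q * Real.log n) :=
    calc K ≤ (⌊c₄ * q⌋₊ + 1) * (Q * Real.log n) := hlog
      _ ≤ (|c₄| + 1) * q * (Q * Real.log n) := mul_le_mul_of_nonneg_right hD (by positivity)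
      _ = _ := by ring
  have h1 : 4 * (B * (N : ℝ) ^ (-r)) ^ 2 ≤ 8 * (B * c₁ ^ (-r)) ^ 2 * δ := by
    have := happ.trans (mul_le_mul_of_nonneg_left hδ₁ (sq_nonneg (B * c₁ ^ (-r))))
    linarith
  have h2 : 1200 * (B + 1) ^ 2 / (c₃ * q) ≤ 2400 * (B + 1) ^ 2 / c₃ * δ :=
    calc 1200 * (B + 1) ^ 2 / (c₃ * q) = 1200 * (B + 1) ^ 2 / c₃ * (1 / q) := by
          field_simp
      _ ≤ 1200 * (B + 1) ^ 2 / c₃ * (2 * δ) := by gcongr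
      _ = _ := by ring
  have h3 : (400 * L ^ 2 * K + 104 * L ^ 2) / n ≤
      (400 * L ^ 2 * ((|c₄| + 1) * Q) + 208 * L ^ 2) * δ := by
    have h4 : 1 ≤ 2 * (q * Real.log n) := by nlinarith
    calc (400 * L ^ 2 * K + 104 * L ^ 2) / n
        ≤ (400 * L ^ 2 * ((|c₄| + 1) * Q * (q * Real.log n)) +
          104 * L ^ 2 * (2 * (q * Real.log n))) / n := by
          refine div_le_div_of_nonneg_right (add_le_add ?_ ?_) hn0.le
          · gcongr
          · exact le_mul_of_one_le_right (by positivity) h4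
      _ = (400 * L ^ 2 * ((|c₄| + 1) * Q) + 208 * L ^ 2) * (q * Real.log n / n) := by ring
      _ ≤ _ := by gcongr
  rw [riskConst, add_mul, add_mul]
  linarith

/-- Here `q = (n / log n) ^ (1/2)` equalizes `1 / q` and `q * log n / n`. -/
theorem rate_div_log {n : ℕ} (hn : 2 ≤ n) :
    1 ≤ ((n : ℝ) / Real.log n) ^ (1 / 2 : ℝ) ∧
    (n : ℝ) ^ (-(1 / 2) : ℝ) ≤ 2 * ((n : ℝ) / Real.log n) ^ (-(1 / 2) : ℝ) ∧
    1 / ((n : ℝ) / Real.log n) ^ (1 / 2 : ℝ) ≤ 2 * ((n : ℝ) / Real.log n) ^ (-(1 / 2) : ℝ) ∧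
    ((n : ℝ) / Real.log n) ^ (1 / 2 : ℝ) * Real.log n / n ≤
      ((n : ℝ) / Real.log n) ^ (-(1 / 2) : ℝ) := by
  have hn0 : (0 : ℝ) < n := by positivity
  have hℓ : 1 / 2 ≤ Real.log n := by
    have h1 := Real.log_le_log two_pos (by exact_mod_cast hn : (2 : ℝ) ≤ n)
    linarith [Real.log_two_gt_d9]
  have hℓ0 : 0 < Real.log n := by linarith
  have hx : 0 < (n : ℝ) / Real.log n := by positivity
  set x := (n : ℝ) / Real.log n with hxdef
  have hneg : x ^ (-(1 / 2) : ℝ) = 1 / x ^ (1 / 2 : ℝ) := by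
    rw [Real.rpow_neg hx.le, ← one_div]
  have hpos : 0 < x ^ (1 / 2 : ℝ) := Real.rpow_pos_of_pos hx _
  refine ⟨?_, ?_, ?_, ?_⟩
  · refine Real.one_le_rpow ?_ (by norm_num)
    rw [hxdef, one_le_div hℓ0]
    exact (Real.log_le_sub_one_of_pos hn0).trans (by linarith)
  · have h1 : x ≤ 4 * n := by
      rw [hxdef, div_le_iff₀ hℓ0]; nlinarith
    have h2 : x ^ (1 / 2 : ℝ) ≤ 2 * (n : ℝ) ^ (1 / 2 : ℝ) := by
      refine (Real.rpow_le_rpow hx.le h1 (by norm_num)).trans_eq ?_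
      rw [Real.mul_rpow (by norm_num) hn0.le, show (4 : ℝ) = 2 ^ (2 : ℝ) by norm_num,
        ← Real.rpow_mul (by norm_num)]
      norm_num
    have hn' : 0 < (n : ℝ) ^ (1 / 2 : ℝ) := Real.rpow_pos_of_pos hn0 _
    rw [hneg, Real.rpow_neg hn0.le, ← one_div, mul_one_div, div_le_div_iff₀ hn' hpos]
    linarith
  · rw [hneg]
    have : 0 < 1 / x ^ (1 / 2 : ℝ) := by positivity
    linarith
  · refine le_of_eq ?_
    have h1 : x ^ (1 / 2 : ℝ) * x ^ (1 / 2 : ℝ) = x := by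
      rw [← Real.rpow_add hx]; norm_num
    rw [hneg, mul_div_assoc, eq_div_iff hpos.ne', mul_right_comm, h1, hxdef]
    field_simp

/-- Here `q = n ^ (1/2)` and the complexity term `q * log n / n` determines the rate. -/
theorem rate_sqrt {n : ℕ} (hn : 2 ≤ n) :
    1 ≤ (n : ℝ) ^ (1 / 2 : ℝ) ∧
    (n : ℝ) ^ (-(1 / 2) : ℝ) ≤ 2 * ((n : ℝ) ^ (-(1 / 2) : ℝ) * Real.log n) ∧
    1 / (n : ℝ) ^ (1 / 2 : ℝ) ≤ 2 * ((n : ℝ) ^ (-(1 / 2) : ℝ) * Real.log n) ∧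
    (n : ℝ) ^ (1 / 2 : ℝ) * Real.log n / n ≤ (n : ℝ) ^ (-(1 / 2) : ℝ) * Real.log n := by
  have hn0 : (0 : ℝ) < n := by positivity
  have hn1 : (1 : ℝ) ≤ n := by exact_mod_cast (by omega : 1 ≤ n)
  have hℓ : 1 / 2 ≤ Real.log n := by
    have h1 := Real.log_le_log two_pos (by exact_mod_cast hn : (2 : ℝ) ≤ n)
    linarith [Real.log_two_gt_d9]
  have hneg : (n : ℝ) ^ (-(1 / 2) : ℝ) = 1 / (n : ℝ) ^ (1 / 2 : ℝ) := by
    rw [Real.rpow_neg hn0.le, ← one_div]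
  have hpos : 0 < (n : ℝ) ^ (-(1 / 2) : ℝ) := Real.rpow_pos_of_pos hn0 _
  have h2 : (n : ℝ) ^ (-(1 / 2) : ℝ) ≤ 2 * ((n : ℝ) ^ (-(1 / 2) : ℝ) * Real.log n) := by
    nlinarith
  refine ⟨Real.one_le_rpow hn1 (by norm_num), h2, by rwa [← hneg], le_of_eq ?_⟩
  have h3 : (n : ℝ) ^ (1 / 2 : ℝ) / n = (n : ℝ) ^ (-(1 / 2) : ℝ) := by
    rw [← Real.rpow_sub_one hn0.ne']; norm_num
  rw [mul_div_right_comm, h3]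

end Rate

/-! ### The two convergence rates -/

theorem corollary1 (L a r c₁ c₂ c₃ c₄ B : ℝ) (hL : 0 < L) (hr : 0 < r) (ha : 1 / (4 * r) ≤ a)
    (hc₁ : 0 < c₁) (hc₃ : 0 < c₃) :
    ∃ C : ℝ, ∀ (X : Type u) [MeasurableSpace X] (ρ : Measure (X × ℝ)) [IsProbabilityMeasure ρ],
      (∀ᵐ p ∂ρ, |p.2| ≤ L) →
      ∀ φ : (N : ℕ) → Fin N → X → ℝ,
      (∀ N i, Measurable (φ N i)) →
      (∀ N i, eLpNorm (φ N i) 2 ρ.fst = 1) →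
      OSGA.MemL1r φ ρ.fst r (OSGA.regression ρ) B →
      ∀ n N : ℕ, 2 ≤ n → c₁ * (n : ℝ) ^ a ≤ N → (N : ℝ) ≤ c₂ * (n : ℝ) ^ a →
      ∀ (s m : (Fin n → X × ℝ) → ℕ) (F : (Fin n → X × ℝ) → X → ℝ),
      Measurable (Function.uncurry F) →
      (∀ᵐ z ∂(Measure.pi fun _ : Fin n => ρ),
        1 ≤ s z ∧ (s z : ℝ≥0∞) ≤ (2 * OSGA.coherence (φ N) z)⁻¹ + 1 ∧
          OSGA.IsEstimator (φ N) z (s z) (m z) (F z)) →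
      ((∀ᵐ z ∂(Measure.pi fun _ : Fin n => ρ),
          c₃ * (((n : ℝ) / Real.log n) ^ (1 / 2 : ℝ) / s z) ≤ m z ∧
            (m z : ℝ) ≤ c₄ * (((n : ℝ) / Real.log n) ^ (1 / 2 : ℝ) / s z)) →
        OSGA.risk ρ L F ≤ ENNReal.ofReal (C * ((n : ℝ) / Real.log n) ^ (-(1 / 2) : ℝ))) ∧
      ((∀ᵐ z ∂(Measure.pi fun _ : Fin n => ρ),
          c₃ * ((n : ℝ) ^ (1 / 2 : ℝ) / s z) ≤ m z ∧
            (m z : ℝ) ≤ c₄ * ((n : ℝ) ^ (1 / 2 : ℝ) / s z)) →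
        OSGA.risk ρ L F ≤ ENNReal.ofReal (C * ((n : ℝ) ^ (-(1 / 2) : ℝ) * Real.log n))) := by
  refine ⟨riskConst L a r c₁ c₂ c₃ c₄ B, ?_⟩
  intro X _ ρ _ hy φ hφ hφ1 hB n N hn hN₁ hN₂ s m F hF hest
  have hN : 0 < N := by
    have : (0 : ℝ) < c₁ * (n : ℝ) ^ a :=
      mul_pos hc₁ (Real.rpow_pos_of_pos (by positivity) a)
    exact_mod_cast this.trans_le hN₁
  constructor
  · intro hm
    obtain ⟨hq, h1, h2, h3⟩ := rate_div_log hn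
    exact (risk_le hL hy hφ hφ1 hB (by omega) hN (by linarith) hc₃ hF hest hm).trans
      (ENNReal.ofReal_le_ofReal (risk_bound_le hr ha hc₁ hc₃ hn hN₁ hN₂ hq h1 h2 h3))
  · intro hm
    obtain ⟨hq, h1, h2, h3⟩ := rate_sqrt hn
    exact (risk_le hL hy hφ hφ1 hB (by omega) hN (by linarith) hc₃ hF hest hm).trans
      (ENNReal.ofReal_le_ofReal (risk_bound_le hr ha hc₁ hc₃ hn hN₁ hN₂ hq h1 h2 h3))
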